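/- Let $v\in(1/2,1)$. Let $$K=\{\Sigma=(\Sigma_1,\Sigma_2,\Sigma_3)\in\mathbb{R}^3 : \Sigma_1+\Sigma_2+\Sigma_3=0,\ \tfrac16(\Sigma_1^2+\Sigma_2^2+\Sigma_3^2)=1\}$$ be the Kasner circle, with the topology and distance induced from $\mathbb{R}^3$, and put $T_1=(2,-1,-1)$, $T_2=(-1,2,-1)$, $T_3=(-1,-1,2)$. For $\alpha\in\{1,2,3\}$ let $A_\alpha=\{\Sigma\in K : \Sigma_\alpha\le -2v\}$; these three arcs are pairwise disjoint. The Kasner circle map $\mathcal{K}:K\to K$ is $$\mathcal{K}(p)=\begin{cases} g_\alpha(p)\,p+(g_\alpha(p)-1)\,\dfrac{T_\alpha}{v}, & p\in A_\alpha,\\ p, & p\notin A_1\cup A_2\cup A_3,\end{cases}\qquad g_\alpha(p)=\frac{1-v^2}{1+v^2+v\Sigma_\alpha}\quad\text{for } p=(\Sigma_1,\Sigma_2,\Sigma_3)\in A_\alpha .$$ (It sends the initial point to the end point of each Bianchi type II heteroclinic orbit.) Let $S=K\setminus\operatorname{int}(A_1\cup A_2\cup A_3)$, the interior being taken in $K$,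 be the stable set, and let $$C=\{p\in K : \mathcal{K}^n(p)\notin S\ \text{for all } n\ge 0\}$$ be the set of points with periodic or infinite heteroclinic chains. Then $C$ is a nonempty Cantor set in $K$, i.e. it is nonempty, closed, without isolated points, and nowhere dense in $K$. It has Lebesgue measure zero, where Lebesgue measure on $K$ is arc length $d\varphi$ in the parametrization $\Sigma_1=-2\cos\varphi$, $\Sigma_2=\cos\varphi+\sqrt3\sin\varphi$, $\Sigma_3=\cos\varphi-\sqrt3\sin\varphi$. Its Hausdorff dimension satisfies $$\frac{\log 2}{\log\left(\frac{2+v^2}{1-v^2}\right)}\ \le\ d_H(C)\ \le\ \min\left\{1,\ \frac{\log 2}{\log\left(\frac{2(1-v^2)}{1+2v^2-\sqrt{12v^2-3}}\right)}\right\}.$$ -/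

import Mathlib

open MeasureTheory

noncomputable section

/-- The Kasner circle: `Σ² = (Σ₁² + Σ₂² + Σ₃²) / 6 = 1` and `Σ₁ + Σ₂ + Σ₃ = 0`. Its points have
vanishing `N₁, N₂, N₃`, so only the coordinates `(Σ₁, Σ₂, Σ₃)` are recorded; the axes `1, 2, 3`
are indexed by `Fin 3`. As a space it carries the topology and distance induced from `ℝ³`. -/
def kasnerCircle : Set (EuclideanSpace ℝ (Fin 3)) :=
  {p | 1 - (p 0 ^ 2 + p 1 ^ 2 + p 2 ^ 2) / 6 = 0 ∧ p 0 + p 1 + p 2 = 0}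

/-- The Taub point `T_α`: coordinate `α` equals `2` and the other two equal `-1`. -/
def taubPoint (α : Fin 3) : EuclideanSpace ℝ (Fin 3) :=
  WithLp.toLp 2 fun β => if β = α then 2 else -1

/-- The closed arc `A_α = {Σ_α ≤ -2v}` of the Kasner circle. -/
def kasnerArc (v : ℝ) (α : Fin 3) : Set kasnerCircle :=
  {p | p.1 α ≤ -2 * v}

/-- The factor `g(p) = (1 - v²) / (1 + v² + Σ_α v)`. -/
def kasnerFactor (v : ℝ) (α : Fin 3) (p : EuclideanSpace ℝ (Fin 3)) : ℝ :=
  (1 - v ^ 2) / (1 + v ^ 2 + p α * v)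

/-- The end point `g(p) p + (g(p) - 1) T_α / v` of the Bianchi type II heteroclinic orbit in the
hemisphere `II_α` that starts at `p ∈ A_α`. -/
def bianchiIIEnd (v : ℝ) (α : Fin 3) (p : EuclideanSpace ℝ (Fin 3)) : EuclideanSpace ℝ (Fin 3) :=
  kasnerFactor v α p • p + (kasnerFactor v α p - 1) • v⁻¹ • taubPoint α

theorem bianchiIIEnd_apply (v : ℝ) (α β : Fin 3) (p : EuclideanSpace ℝ (Fin 3)) :
    bianchiIIEnd v α p β =
      kasnerFactor v α p * p β + (kasnerFactor v α p - 1) * (v⁻¹ * if β = α then 2 else -1) := by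
  simp [bianchiIIEnd, taubPoint]

theorem bianchiIIEnd_aux (v x y z g : ℝ) (h1 : 1 - (x ^ 2 + y ^ 2 + z ^ 2) / 6 = 0)
    (h2 : x + y + z = 0) (hg : g = (1 - v ^ 2) / (1 + v ^ 2 + x * v)) :
    1 - ((g * x + (g - 1) * (v⁻¹ * 2)) ^ 2 + (g * y + (g - 1) * (v⁻¹ * (-1))) ^ 2
      + (g * z + (g - 1) * (v⁻¹ * (-1))) ^ 2) / 6 = 0 := by
  obtain rfl : z = -x - y := by linarith
  have key : 1 - ((g * x + (g - 1) * (v⁻¹ * 2)) ^ 2 + (g * y + (g - 1) * (v⁻¹ * (-1))) ^ 2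
      + (g * (-x - y) + (g - 1) * (v⁻¹ * (-1))) ^ 2) / 6
      = 1 - g ^ 2 - (g - 1) ^ 2 * v⁻¹ ^ 2 - g * (g - 1) * v⁻¹ * x := by
    linear_combination g ^ 2 * h1
  rw [key]
  rcases eq_or_ne v 0 with rfl | hv
  · simp at hg
    simp [hg]
  have hx : -2 ≤ x ∧ x ≤ 2 := by
    constructor <;> nlinarith [sq_nonneg (x + 2 * y), sq_nonneg (x - 2), sq_nonneg (x + 2)]
  rcases eq_or_ne (1 + v ^ 2 + x * v) 0 with hd | hd
  · have hv1 : v ^ 2 = 1 := by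
      have h : (v ^ 2 - 1) ^ 2 ≤ 0 := by
        have hxv : x * v = -(1 + v ^ 2) := by linarith
        have h3 : (1 + v ^ 2) ^ 2 = x ^ 2 * v ^ 2 := by rw [← mul_pow, hxv]; ring
        have h4 : x ^ 2 ≤ 4 := by nlinarith
        nlinarith [mul_le_mul_of_nonneg_right h4 (sq_nonneg v)]
      nlinarith [sq_nonneg (v ^ 2 - 1)]
    have hg0 : g = 0 := by rw [hg, hd, div_zero]
    have hi : v⁻¹ ^ 2 = 1 := by rw [inv_pow, hv1, inv_one]
    rw [hg0]
    linear_combination -hi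
  · have hg' : g * (1 + v ^ 2 + x * v) = 1 - v ^ 2 := by
      rw [hg, div_mul_cancel₀ _ hd]
    field_simp
    linear_combination (1 - g) * hg'

/-- The end point lies on the Kasner circle again. -/
theorem bianchiIIEnd_mem (v : ℝ) (α : Fin 3) {p : EuclideanSpace ℝ (Fin 3)}
    (hp : p ∈ kasnerCircle) : bianchiIIEnd v α p ∈ kasnerCircle := by
  obtain ⟨h1, h2⟩ := hp
  refine ⟨?_, ?_⟩
  · fin_cases α
    · have := bianchiIIEnd_aux v (p 0) (p 1) (p 2) (kasnerFactor v 0 p) h1 h2 rfl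
      simp only [bianchiIIEnd_apply]
      simp
      linarith
    · have := bianchiIIEnd_aux v (p 1) (p 2) (p 0) (kasnerFactor v 1 p) (by linarith)
        (by linarith) rfl
      simp only [bianchiIIEnd_apply]
      simp
      linarith
    · have := bianchiIIEnd_aux v (p 2) (p 0) (p 1) (kasnerFactor v 2 p) (by linarith)
        (by linarith) rfl
      simp only [bianchiIIEnd_apply]
      simp
      linarith
  · simp only [bianchiIIEnd_apply]
    fin_cases α
    · simp
      linear_combination kasnerFactor v 0 p * h2
    · simp
      linear_combination kasnerFactor v 1 p * h2
    · simp
      linear_combination kasnerFactor v 2 p * h2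

/-- `bianchiIIEnd` as a map of the Kasner circle to itself. -/
def bianchiIIMap (v : ℝ) (α : Fin 3) (p : kasnerCircle) : kasnerCircle :=
  ⟨bianchiIIEnd v α p.1, bianchiIIEnd_mem v α p.2⟩

open Classical in
/-- The Kasner circle map. For `1/2 < v` the three arcs are pairwise disjoint (see
`kasnerMap_of_mem`), so the order of the case distinction does not matter. -/
def kasnerMap (v : ℝ) (p : kasnerCircle) : kasnerCircle :=
  if p ∈ kasnerArc v 0 then bianchiIIMap v 0 p
  else if p ∈ kasnerArc v 1 then bianchiIIMap v 1 p
  else if p ∈ kasnerArc v 2 then bianchiIIMap v 2 p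
  else p

theorem kasnerArc_unique {v : ℝ} (hv : 1 / 2 < v) {α β : Fin 3} {p : kasnerCircle}
    (hα : p ∈ kasnerArc v α) (hβ : p ∈ kasnerArc v β) : α = β := by
  obtain ⟨p, h1, h2⟩ := p
  simp only [kasnerArc, Set.mem_ofPred_eq] at hα hβ
  have key : ∀ x y z : ℝ, x ^ 2 + y ^ 2 + z ^ 2 = 6 → x + y + z = 0 → x ≤ -2 * v →
      y ≤ -2 * v → False := by
    intro x y z h1 h2 hx hy
    nlinarith [sq_nonneg (x - y)]
  fin_cases α <;> fin_cases β <;> first | rfl | (exfalso; simp at hα hβ)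
  · exact key (p 0) (p 1) (p 2) (by linarith) (by linarith) (by linarith) (by linarith)
  · exact key (p 0) (p 2) (p 1) (by linarith) (by linarith) (by linarith) (by linarith)
  · exact key (p 0) (p 1) (p 2) (by linarith) (by linarith) (by linarith) (by linarith)
  · exact key (p 1) (p 2) (p 0) (by linarith) (by linarith) (by linarith) (by linarith)
  · exact key (p 0) (p 2) (p 1) (by linarith) (by linarith) (by linarith) (by linarith)
  · exact key (p 1) (p 2) (p 0) (by linarith) (by linarith) (by linarith) (by linarith)

theorem kasnerMap_of_mem {v : ℝ} (hv : 1 / 2 < v) {α : Fin 3} {p : kasnerCircle}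
    (hp : p ∈ kasnerArc v α) : kasnerMap v p = bianchiIIMap v α p := by
  have h : ∀ β, p ∈ kasnerArc v β → β = α := fun β hβ => kasnerArc_unique hv hβ hp
  unfold kasnerMap
  split_ifs with h0 h1 h2
  · rw [h 0 h0]
  · rw [h 1 h1]
  · rw [h 2 h2]
  · exfalso
    fin_cases α
    exacts [h0 hp, h1 hp, h2 hp]

theorem kasnerMap_of_notMem {v : ℝ} {p : kasnerCircle} (hp : ∀ α, p ∉ kasnerArc v α) :
    kasnerMap v p = p := by
  simp [kasnerMap, hp]

/-- The stable set `S`: the complement in the Kasner circle of the interior of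
`A₁ ∪ A₂ ∪ A₃`. -/
def stableSet (v : ℝ) : Set kasnerCircle :=
  (interior (⋃ α, kasnerArc v α))ᶜ

/-- The set `C` of points whose orbit under the Kasner circle map never meets `S`. -/
def infiniteChainSet (v : ℝ) : Set kasnerCircle :=
  {p | ∀ n : ℕ, (kasnerMap v)^[n] p ∉ stableSet v}

/-- A Cantor set: nonempty, perfect (closed without isolated points) and nowhere dense. -/
def IsCantorSet {X : Type*} [TopologicalSpace X] (E : Set X) : Prop :=
  E.Nonempty ∧ Perfect E ∧ IsNowhereDense E

/-- The point `Σ₊ = cos φ`, `Σ₋ = sin φ` of the Kasner circle, where `Σ₁ = -2 Σ₊`,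
`Σ₂ = Σ₊ + √3 Σ₋`, `Σ₃ = Σ₊ - √3 Σ₋`. -/
def kasnerPoint (φ : ℝ) : kasnerCircle :=
  ⟨!₂[-2 * Real.cos φ, Real.cos φ + √3 * Real.sin φ, Real.cos φ - √3 * Real.sin φ], by
    have h3 : √3 ^ 2 = (3 : ℝ) := Real.sq_sqrt (by norm_num)
    refine ⟨?_, ?_⟩
    · simp
      linear_combination -(1 / 3) * Real.sin φ ^ 2 * h3 - Real.sin_sq_add_cos_sq φ
    · simp
      ring⟩

theorem continuous_kasnerPoint : Continuous kasnerPoint := by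
  refine Continuous.subtype_mk ?_ _
  refine (PiLp.continuous_toLp 2 _).comp (continuous_pi fun i => ?_)
  fin_cases i <;> simp <;> fun_prop

/-- Lebesgue measure on the Kasner circle: arc length of the unit circle in `(Σ₊, Σ₋)`. -/
def kasnerLength : Measure kasnerCircle :=
  (volume.restrict (Set.Ioc (-Real.pi) Real.pi)).map kasnerPoint

theorem kasnerLength_univ : kasnerLength Set.univ = ENNReal.ofReal (2 * Real.pi) := by
  rw [kasnerLength, Measure.map_apply continuous_kasnerPoint.measurable MeasurableSet.univ]
  rw [Set.preimage_univ, Measure.restrict_apply_univ, Real.volume_Ioc]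
  congr 1
  ring

end

namespace Kasner

open Set Filter Topology
open scoped NNReal ENNReal

variable {v : ℝ} {α β : Fin 3} {p q : kasnerCircle}

/-! ### The geometry of the type II maps -/

/-! Each type II map, taken on all of K, is the inversion with centre -T_α/v. It is an involution
that exchanges the interior of A_α with the complement of A_α, and it scales squared distances by
g(p) g(q) (`dist_bianchiIIMap_sq`). So C ∩ A_α is made of the images of the parts of C in the other
two arcs, and every letter sequence without immediate repetition is the itinerary of a point of C
(`exists_itinerary`).

The rates on C follow from one estimate, p_γ ≤ 1/v (`coord_le_inv`). It gives m ≤ g ≤ M on C, where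
m and M are the arguments of the two logarithms (`minFactor_le_factor`, `factor_le_maxFactor`).
Contraction of the inverse branches by 1/m excludes isolated points and covers C ∩ A_α by 2^n sets
of diameter at most 7 m^(-n), whence the upper bound. Expansion by at most M makes the binary coding
of itineraries Hölder of exponent log 2 / log M; it maps C ∩ A_0 onto [0,1], whence the lower bound.

Measure zero does not follow from this, since m may be below 2. It rests on bounded distortion:
along every composition of inverse branches, the complement of the three arcs removes at least a
fixed proportion of length (`exists_mul_measure_le`), so n steps leave at most (1-c)^n. As nonempty
open sets have positive length, C is then nowhere dense. -/

theorem coord_rel (p : kasnerCircle) (h : α ≠ β) :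
    p.1 α ^ 2 + p.1 α * p.1 β + p.1 β ^ 2 = 3 := by
  obtain ⟨p, h1, h2⟩ := p
  have key : ∀ x y z : ℝ, 1 - (x ^ 2 + y ^ 2 + z ^ 2) / 6 = 0 → x + y + z = 0 →
      x ^ 2 + x * y + y ^ 2 = 3 := by
    intro x y z h1 h2
    obtain rfl : z = -x - y := by linarith
    linear_combination -3 * h1
  fin_cases α <;> fin_cases β <;> first | exact absurd rfl h | skip
  · exact key (p 0) (p 1) (p 2) (by linarith) (by linarith)
  · exact key (p 0) (p 2) (p 1) (by linarith) (by linarith)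
  · exact key (p 1) (p 0) (p 2) (by linarith) (by linarith)
  · exact key (p 1) (p 2) (p 0) (by linarith) (by linarith)
  · exact key (p 2) (p 0) (p 1) (by linarith) (by linarith)
  · exact key (p 2) (p 1) (p 0) (by linarith) (by linarith)

theorem coord_add_add (p : kasnerCircle) {γ : Fin 3} (h₁ : α ≠ β) (h₂ : α ≠ γ) (h₃ : β ≠ γ) :
    p.1 α + p.1 β + p.1 γ = 0 := by
  obtain ⟨p, h1, h2⟩ := p
  fin_cases α <;> fin_cases β <;> fin_cases γ <;> simp at h₁ h₂ h₃ ⊢ <;> linarith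

theorem coord_mem_Icc (p : kasnerCircle) (α : Fin 3) : p.1 α ∈ Icc (-2) 2 := by
  have h : α ≠ α + 1 := by fin_cases α <;> decide
  have := coord_rel p h
  constructor <;> nlinarith [sq_nonneg (p.1 α + 2 * p.1 (α + 1)), sq_nonneg (p.1 α - 2),
    sq_nonneg (p.1 α + 2)]

/-- Two coordinates of a point of the Kasner circle cannot both be less than `-1`. -/
theorem neg_one_lt_coord (hv : 1 / 2 < v) (hp : p ∈ kasnerArc v β) (h : α ≠ β) :
    -1 < p.1 α := by
  have h1 := coord_rel p h
  have h2 : p.1 β ≤ -2 * v := hp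
  by_contra! h3
  nlinarith

theorem abs_coord_sub_le_dist (p q : kasnerCircle) (α : Fin 3) :
    |p.1 α - q.1 α| ≤ dist p q := by
  have := PiLp.norm_apply_le (p.1 - q.1) α
  rwa [PiLp.sub_apply, Real.norm_eq_abs, ← dist_eq_norm, ← Subtype.dist_eq] at this

/-- Coordinate α is at most -2v on one arc and above -1 on the other. This separation drives both
the distortion bound and the Hölder constant. -/
theorem le_dist_of_mem_arc (hv : 1 / 2 < v) (hp : p ∈ kasnerArc v α) (hq : q ∈ kasnerArc v β)
    (h : α ≠ β) : 2 * v - 1 ≤ dist p q := by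
  have h1 := neg_one_lt_coord hv hq h
  have h2 : p.1 α ≤ -2 * v := hp
  have h3 := abs_coord_sub_le_dist p q α
  have h4 := neg_abs_le (p.1 α - q.1 α)
  linarith

theorem dist_sq (p q : kasnerCircle) :
    dist p q ^ 2 = (p.1 0 - q.1 0) ^ 2 + (p.1 1 - q.1 1) ^ 2 + (p.1 2 - q.1 2) ^ 2 := by
  rw [Subtype.dist_eq, EuclideanSpace.dist_eq, Real.sq_sqrt (by positivity)]
  simp [Fin.sum_univ_three, Real.dist_eq, sq_abs]

/-- Three squared differences of at most 16 sum to 48 < 7²; any bound on the diameter would serve.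
-/
theorem dist_le (p q : kasnerCircle) : dist p q ≤ 7 := by
  have h := dist_sq p q
  have h0 := coord_mem_Icc p 0
  have h1 := coord_mem_Icc p 1
  have h2 := coord_mem_Icc p 2
  have k0 := coord_mem_Icc q 0
  have k1 := coord_mem_Icc q 1
  have k2 := coord_mem_Icc q 2
  simp only [mem_Icc] at *
  have a0 : (p.1 0 - q.1 0) ^ 2 ≤ 16 := by nlinarith
  have a1 : (p.1 1 - q.1 1) ^ 2 ≤ 16 := by nlinarith
  have a2 : (p.1 2 - q.1 2) ^ 2 ≤ 16 := by nlinarith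
  nlinarith

/-- The scaling factor of the type II map as a function on the Kasner circle. -/
noncomputable abbrev factor (v : ℝ) (α : Fin 3) (p : kasnerCircle) : ℝ := kasnerFactor v α p.1

theorem factor_denom_pos (hv : v ∈ Ioo (1 / 2 : ℝ) 1) (p : kasnerCircle) (α : Fin 3) :
    0 < 1 + v ^ 2 + p.1 α * v := by
  have h := coord_mem_Icc p α
  obtain ⟨h1, h2⟩ := hv
  nlinarith [h.1, mul_pos (sub_pos.2 h2) (sub_pos.2 h2)]

theorem one_sub_sq_pos (hv : v ∈ Ioo (1 / 2 : ℝ) 1) : 0 < 1 - v ^ 2 := by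
  nlinarith [hv.1, hv.2]

theorem factor_mul_denom (hv : v ∈ Ioo (1 / 2 : ℝ) 1) (p : kasnerCircle) (α : Fin 3) :
    factor v α p * (1 + v ^ 2 + p.1 α * v) = 1 - v ^ 2 :=
  div_mul_cancel₀ _ (factor_denom_pos hv p α).ne'

theorem factor_pos (hv : v ∈ Ioo (1 / 2 : ℝ) 1) (p : kasnerCircle) (α : Fin 3) :
    0 < factor v α p :=
  div_pos (one_sub_sq_pos hv) (factor_denom_pos hv p α)

theorem bianchiIIMap_apply_self :
    (bianchiIIMap v α p).1 α = factor v α p * p.1 α + (factor v α p - 1) * (v⁻¹ * 2) := by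
  simp [bianchiIIMap, bianchiIIEnd_apply]

theorem bianchiIIMap_apply_of_ne (h : β ≠ α) :
    (bianchiIIMap v α p).1 β = factor v α p * p.1 β - (factor v α p - 1) * v⁻¹ := by
  simp [bianchiIIMap, bianchiIIEnd_apply, h, sub_eq_add_neg]

/-- The map multiplies p + T_α/v by g(p), and g(p) is 6(1-v²)/v² divided by |p + T_α/v|². This is an
inversion, so the factor at the image is the reciprocal. -/
theorem factor_bianchiIIMap (hv : v ∈ Ioo (1 / 2 : ℝ) 1) (p : kasnerCircle) (α : Fin 3) :
    factor v α (bianchiIIMap v α p) = (factor v α p)⁻¹ := by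
  have h := factor_mul_denom hv p α
  have hg := factor_pos hv p α
  have hv0 : v ≠ 0 := by linarith [hv.1]
  have h1 := one_sub_sq_pos hv
  have : 1 + v ^ 2 + (bianchiIIMap v α p).1 α * v = factor v α p * (1 - v ^ 2) := by
    rw [bianchiIIMap_apply_self]
    field_simp
    linear_combination h
  rw [factor, kasnerFactor, this]
  field_simp

theorem bianchiIIMap_involutive (hv : v ∈ Ioo (1 / 2 : ℝ) 1) (α : Fin 3) :
    Function.Involutive (bianchiIIMap v α) := by
  intro p
  have hg := factor_pos hv p α
  have hv0 : v ≠ 0 := by linarith [hv.1]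
  ext β
  rcases eq_or_ne β α with rfl | h
  · rw [bianchiIIMap_apply_self, factor_bianchiIIMap hv, bianchiIIMap_apply_self]
    field_simp
    ring
  · rw [bianchiIIMap_apply_of_ne h, factor_bianchiIIMap hv, bianchiIIMap_apply_of_ne h]
    field_simp
    ring

/-- The type II map is the restriction of an inversion; this is the distortion of distances. -/
theorem dist_bianchiIIMap_sq (hv : v ∈ Ioo (1 / 2 : ℝ) 1) (α : Fin 3) (p q : kasnerCircle) :
    dist (bianchiIIMap v α p) (bianchiIIMap v α q) ^ 2 =
      factor v α p * factor v α q * dist p q ^ 2 := by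
  have hv0 : v ≠ 0 := by linarith [hv.1]
  -- Here x is the coordinate α; the other two transform alike, so one identity serves all three
  -- axes.
  have key : ∀ x y z x' y' z' g g' : ℝ, x + y + z = 0 → x' + y' + z' = 0 →
      x ^ 2 + x * y + y ^ 2 = 3 → x' ^ 2 + x' * y' + y' ^ 2 = 3 →
      g * (1 + v ^ 2 + x * v) = 1 - v ^ 2 → g' * (1 + v ^ 2 + x' * v) = 1 - v ^ 2 →
      (g * x + (g - 1) * (v⁻¹ * 2) - (g' * x' + (g' - 1) * (v⁻¹ * 2))) ^ 2
      + (g * y - (g - 1) * v⁻¹ - (g' * y' - (g' - 1) * v⁻¹)) ^ 2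
      + (g * z - (g - 1) * v⁻¹ - (g' * z' - (g' - 1) * v⁻¹)) ^ 2
      = g * g' * ((x - x') ^ 2 + (y - y') ^ 2 + (z - z') ^ 2) := by
    intro x y z x' y' z' g g' h1 h2 h3 h4 h5 h6
    obtain rfl : z = -x - y := by linarith
    obtain rfl : z' = -x' - y' := by linarith
    field_simp
    linear_combination (v ^ 2 * 2 * g ^ 2 - 2 * v ^ 2 * g * g') * h3
      + (v ^ 2 * 2 * g' ^ 2 - 2 * v ^ 2 * g * g') * h4 + 6 * (g - g') * (h5 - h6)
  have hp := factor_mul_denom hv p α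
  have hq := factor_mul_denom hv q α
  rw [dist_sq, dist_sq]
  have h01 : (0 : Fin 3) ≠ 1 := by decide
  have h02 : (0 : Fin 3) ≠ 2 := by decide
  have h12 : (1 : Fin 3) ≠ 2 := by decide
  obtain rfl | rfl | rfl : α = 0 ∨ α = 1 ∨ α = 2 := by fin_cases α <;> simp
  · have := key _ _ _ _ _ _ _ _ (coord_add_add p h01 h02 h12) (coord_add_add q h01 h02 h12)
      (coord_rel p h01) (coord_rel q h01) hp hq
    rw [bianchiIIMap_apply_self, bianchiIIMap_apply_self, bianchiIIMap_apply_of_ne h01.symm,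
      bianchiIIMap_apply_of_ne h01.symm, bianchiIIMap_apply_of_ne h02.symm,
      bianchiIIMap_apply_of_ne h02.symm]
    linarith
  · have := key _ _ _ _ _ _ _ _ (coord_add_add p h01.symm h12 h02)
      (coord_add_add q h01.symm h12 h02) (coord_rel p h01.symm) (coord_rel q h01.symm) hp hq
    rw [bianchiIIMap_apply_self, bianchiIIMap_apply_self, bianchiIIMap_apply_of_ne h01,
      bianchiIIMap_apply_of_ne h01, bianchiIIMap_apply_of_ne h12.symm,
      bianchiIIMap_apply_of_ne h12.symm]
    linarith
  · have := key _ _ _ _ _ _ _ _ (coord_add_add p h02.symm h12.symm h01)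
      (coord_add_add q h02.symm h12.symm h01) (coord_rel p h02.symm) (coord_rel q h02.symm) hp hq
    rw [bianchiIIMap_apply_self, bianchiIIMap_apply_self, bianchiIIMap_apply_of_ne h02,
      bianchiIIMap_apply_of_ne h02, bianchiIIMap_apply_of_ne h12,
      bianchiIIMap_apply_of_ne h12]
    linarith

theorem one_le_factor_iff (hv : v ∈ Ioo (1 / 2 : ℝ) 1) :
    1 ≤ factor v α p ↔ p ∈ kasnerArc v α := by
  rw [factor, kasnerFactor, one_le_div (factor_denom_pos hv p α)]
  change _ ↔ p.1 α ≤ -2 * v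
  have := hv.1
  constructor <;> intro h <;> nlinarith

theorem one_lt_factor_iff (hv : v ∈ Ioo (1 / 2 : ℝ) 1) :
    1 < factor v α p ↔ p.1 α < -2 * v := by
  rw [factor, kasnerFactor, one_lt_div (factor_denom_pos hv p α)]
  have := hv.1
  constructor <;> intro h <;> nlinarith

theorem bianchiIIMap_apply_self_lt (hv : v ∈ Ioo (1 / 2 : ℝ) 1) (hp : p ∉ kasnerArc v α) :
    (bianchiIIMap v α p).1 α < -2 * v := by
  rw [← one_lt_factor_iff hv, factor_bianchiIIMap hv]
  exact (one_lt_inv₀ (factor_pos hv p α)).2 (not_le.1 (mt (one_le_factor_iff hv).1 hp))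

theorem bianchiIIMap_mem_arc (hv : v ∈ Ioo (1 / 2 : ℝ) 1) (hp : p ∉ kasnerArc v α) :
    bianchiIIMap v α p ∈ kasnerArc v α := (bianchiIIMap_apply_self_lt hv hp).le

theorem bianchiIIMap_notMem_arc (hv : v ∈ Ioo (1 / 2 : ℝ) 1) (hp : p.1 α < -2 * v) :
    bianchiIIMap v α p ∉ kasnerArc v α := by
  rw [← one_le_factor_iff hv, factor_bianchiIIMap hv, not_le]
  exact inv_lt_one_of_one_lt₀ ((one_lt_factor_iff hv).2 hp)

theorem bianchiIIMap_eq_self (hv : v ∈ Ioo (1 / 2 : ℝ) 1) (hp : p.1 α = -2 * v) :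
    bianchiIIMap v α p = p := by
  have hg : factor v α p = 1 := by
    have h := factor_mul_denom hv p α
    have h1 := one_sub_sq_pos hv
    rw [hp] at h
    exact mul_right_cancel₀ h1.ne' (by linarith)
  ext β
  rcases eq_or_ne β α with rfl | h
  · simp [bianchiIIMap_apply_self, hg]
  · simp [bianchiIIMap_apply_of_ne h, hg]

theorem notMem_arc (hv : 1 / 2 < v) (hp : p ∈ kasnerArc v β) (h : α ≠ β) :
    p ∉ kasnerArc v α := fun h' => h (kasnerArc_unique hv h' hp)

theorem kasnerMap_bianchiIIMap (hv : v ∈ Ioo (1 / 2 : ℝ) 1) (hp : p ∉ kasnerArc v α) :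
    kasnerMap v (bianchiIIMap v α p) = p := by
  rw [kasnerMap_of_mem hv.1 (bianchiIIMap_mem_arc hv hp), bianchiIIMap_involutive hv]

/-! ### Continuity -/

theorem continuous_coord (α : Fin 3) : Continuous fun p : kasnerCircle => p.1 α := by
  fun_prop

theorem isClosed_arc (v : ℝ) (α : Fin 3) : IsClosed (kasnerArc v α) :=
  isClosed_le (continuous_coord α) continuous_const

theorem continuous_factor (hv : v ∈ Ioo (1 / 2 : ℝ) 1) (α : Fin 3) : Continuous (factor v α) :=
  continuous_const.div (by fun_prop) fun p => (factor_denom_pos hv p α).ne'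

theorem continuous_bianchiIIMap (hv : v ∈ Ioo (1 / 2 : ℝ) 1) (α : Fin 3) :
    Continuous (bianchiIIMap v α) := by
  have h := continuous_factor hv α
  refine Continuous.subtype_mk ?_ _
  exact (h.smul continuous_subtype_val).add ((h.sub continuous_const).smul continuous_const)

/-- The circle is covered by four closed sets: the arcs, and the set where all coordinates are at
least -2v. The definitions agree on overlaps because the end points of the arcs are fixed. -/
theorem continuous_kasnerMap (hv : v ∈ Ioo (1 / 2 : ℝ) 1) : Continuous (kasnerMap v) := by
  have hA : ∀ α, ContinuousOn (kasnerMap v) (kasnerArc v α) := fun α =>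
    (continuous_bianchiIIMap hv α).continuousOn.congr fun p hp => kasnerMap_of_mem hv.1 hp
  set S : Set kasnerCircle := {p | ∀ α, -2 * v ≤ p.1 α} with hS
  have hSc : IsClosed S := by
    simp only [hS, ofPred_forall]
    exact isClosed_iInter fun α => isClosed_le continuous_const (continuous_coord α)
  have hSf : ContinuousOn (kasnerMap v) S := by
    refine continuousOn_id.congr fun p hp => ?_
    by_cases h : ∃ α, p ∈ kasnerArc v α
    · obtain ⟨α, h⟩ := h
      rw [kasnerMap_of_mem hv.1 h]
      exact bianchiIIMap_eq_self hv (le_antisymm h (hp α))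
    · exact kasnerMap_of_notMem (not_exists.1 h)
  have h := (((hA 0).union_of_isClosed (hA 1) (isClosed_arc v 0) (isClosed_arc v 1)
    ).union_of_isClosed (hA 2) ((isClosed_arc v 0).union (isClosed_arc v 1)) (isClosed_arc v 2)
    ).union_of_isClosed hSf
      (((isClosed_arc v 0).union (isClosed_arc v 1)).union (isClosed_arc v 2)) hSc
  rw [← continuousOn_univ]
  refine h.mono fun p _ => ?_
  by_contra hp
  simp only [mem_union, not_or] at hp
  refine hp.2 fun α => ?_
  fin_cases α
  exacts [(not_le.1 hp.1.1.1).le, (not_le.1 hp.1.1.2).le, (not_le.1 hp.1.2).le]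

instance : CompactSpace kasnerCircle := by
  refine isCompact_iff_compactSpace.1 (Metric.isCompact_of_isClosed_isBounded ?_ ?_)
  · refine (isClosed_eq ?_ continuous_const).inter (isClosed_eq ?_ continuous_const) <;> fun_prop
  · exact Metric.isBounded_iff.2 ⟨7, fun x hx y hy => dist_le ⟨x, hx⟩ ⟨y, hy⟩⟩

/-! ### The parametrization -/

theorem exists_kasnerPoint_eq (p : kasnerCircle) :
    ∃ φ ∈ Ioc (-Real.pi) Real.pi, kasnerPoint φ = p := by
  have h3 : √3 ^ 2 = (3 : ℝ) := Real.sq_sqrt (by norm_num)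
  have h3' : √3 ≠ (0 : ℝ) := by positivity
  have h01 := coord_rel p (show (0 : Fin 3) ≠ 1 by decide)
  have hs := coord_add_add p (show (0 : Fin 3) ≠ 1 by decide) (show (0 : Fin 3) ≠ 2 by decide)
    (show (1 : Fin 3) ≠ 2 by decide)
  -- The point is z = Σ₊ + iΣ₋ on the unit circle, and φ is its argument.
  obtain ⟨z, hre, him⟩ : ∃ z : ℂ, z.re = -p.1 0 / 2 ∧ z.im = (p.1 1 - p.1 2) / (2 * √3) :=
    ⟨⟨_, _⟩, rfl, rfl⟩
  have hn : ‖z‖ = 1 := by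
    rw [Complex.norm_eq_sqrt_sq_add_sq, Real.sqrt_eq_one, hre, him]
    have h2 : p.1 2 = -p.1 0 - p.1 1 := by linarith
    simp only [h2, div_pow, mul_pow, h3]
    linear_combination (1 / 3) * h01
  have hc := Complex.norm_mul_cos_arg z
  have hs' := Complex.norm_mul_sin_arg z
  rw [hn, one_mul] at hc hs'
  refine ⟨z.arg, Complex.arg_mem_Ioc z, Subtype.ext ?_⟩
  ext i
  simp only [kasnerPoint, hc, hs', hre, him]
  fin_cases i <;> simp <;> field_simp <;> linarith

theorem hasDerivAt_kasnerPoint_coord (φ : ℝ) (α : Fin 3) :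
    ∃ d, HasDerivAt (fun t => (kasnerPoint t).1 α) d φ ∧ (kasnerPoint φ).1 α ^ 2 + d ^ 2 = 4 := by
  have h3 : √3 ^ 2 = (3 : ℝ) := Real.sq_sqrt (by norm_num)
  have hcs := Real.sin_sq_add_cos_sq φ
  have hc := Real.hasDerivAt_cos φ
  have hs := (Real.hasDerivAt_sin φ).const_mul √3
  obtain rfl | rfl | rfl : α = 0 ∨ α = 1 ∨ α = 2 := by fin_cases α <;> simp
  · refine ⟨_, hc.const_mul (-2), ?_⟩
    simp [kasnerPoint]
    linear_combination 4 * hcs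
  · refine ⟨_, hc.add hs, ?_⟩
    simp [kasnerPoint]
    linear_combination 4 * hcs + (Real.sin φ ^ 2 + Real.cos φ ^ 2) * h3
  · refine ⟨_, hc.sub hs, ?_⟩
    simp [kasnerPoint]
    linear_combination 4 * hcs + (Real.sin φ ^ 2 + Real.cos φ ^ 2) * h3

/-! ### The set of infinite chains -/

/-- An end point of A_α is not interior to the union: otherwise coordinate α would have a local
maximum -2v there. Its derivative d would vanish, while d² = 4 - 4v² > 0. -/
theorem notMem_stableSet_iff (hv : v ∈ Ioo (1 / 2 : ℝ) 1) :
    p ∉ stableSet v ↔ ∃ α, p.1 α < -2 * v := by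
  rw [stableSet, notMem_compl_iff]
  constructor
  · intro hp
    obtain ⟨α, hα⟩ := mem_iUnion.1 (interior_subset hp)
    refine ⟨α, lt_of_le_of_ne hα fun heq => ?_⟩
    obtain ⟨φ, -, rfl⟩ := exists_kasnerPoint_eq p
    have hn : ∀ᶠ t in 𝓝 φ, kasnerPoint t ∈ interior (⋃ α, kasnerArc v α) :=
      continuous_kasnerPoint.continuousAt (isOpen_interior.mem_nhds hp)
    have hn' : ∀ᶠ t in 𝓝 φ, ∀ β, β ≠ α → kasnerPoint t ∉ kasnerArc v β := by
      refine eventually_all.2 fun β => ?_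
      by_cases hβ : β = α
      · simp [hβ]
      · filter_upwards [continuous_kasnerPoint.continuousAt
          ((isClosed_arc v β).isOpen_compl.mem_nhds (notMem_arc hv.1 hα hβ))] with t ht _ using ht
    have hmax : IsLocalMax (fun t => (kasnerPoint t).1 α) φ := by
      filter_upwards [hn, hn'] with t ht ht'
      obtain ⟨β, hβ⟩ := mem_iUnion.1 (interior_subset ht)
      by_cases hβα : β = α
      · subst hβα
        rw [heq]
        exact hβ
      · exact absurd hβ (ht' β hβα)
    obtain ⟨d, hd, hd'⟩ := hasDerivAt_kasnerPoint_coord φ α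
    rw [hmax.hasDerivAt_eq_zero hd, heq] at hd'
    nlinarith [hv.1, hv.2]
  · rintro ⟨α, hα⟩
    have ho : IsOpen {p : kasnerCircle | p.1 α < -2 * v} :=
      isOpen_lt (continuous_coord α) continuous_const
    exact interior_maximal (fun q hq => mem_iUnion.2
      ⟨α, (show q.1 α < -2 * v from hq).le⟩) ho hα

theorem mem_infiniteChainSet_iff (hv : v ∈ Ioo (1 / 2 : ℝ) 1) :
    p ∈ infiniteChainSet v ↔ ∀ n, ∃ α, ((kasnerMap v)^[n] p).1 α < -2 * v :=
  forall_congr' fun _ => notMem_stableSet_iff hv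

theorem exists_mem_arc (hv : v ∈ Ioo (1 / 2 : ℝ) 1) (hp : p ∈ infiniteChainSet v) :
    ∃ α, p ∈ kasnerArc v α := by
  obtain ⟨α, hα⟩ := (mem_infiniteChainSet_iff hv).1 hp 0
  exact ⟨α, hα.le⟩

theorem coord_lt (hv : v ∈ Ioo (1 / 2 : ℝ) 1) (hp : p ∈ infiniteChainSet v)
    (hα : p ∈ kasnerArc v α) : p.1 α < -2 * v := by
  obtain ⟨β, hβ⟩ := (mem_infiniteChainSet_iff hv).1 hp 0
  rwa [kasnerArc_unique hv.1 hα hβ.le]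

theorem kasnerMap_mem (hp : p ∈ infiniteChainSet v) : kasnerMap v p ∈ infiniteChainSet v :=
  fun n => hp (n + 1)

theorem iterate_kasnerMap_mem (hp : p ∈ infiniteChainSet v) (n : ℕ) :
    (kasnerMap v)^[n] p ∈ infiniteChainSet v := by
  induction n with
  | zero => exact hp
  | succ n ih => rw [Function.iterate_succ_apply']; exact kasnerMap_mem ih

theorem bianchiIIMap_mem (hv : v ∈ Ioo (1 / 2 : ℝ) 1) (hp : p ∈ infiniteChainSet v)
    (hα : p ∈ kasnerArc v α) : bianchiIIMap v α p ∈ infiniteChainSet v := by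
  rw [← kasnerMap_of_mem hv.1 hα]
  exact kasnerMap_mem hp

theorem exists_bianchiIIMap_mem_arc (hv : v ∈ Ioo (1 / 2 : ℝ) 1) (hp : p ∈ infiniteChainSet v)
    (hα : p ∈ kasnerArc v α) : ∃ β, β ≠ α ∧ bianchiIIMap v α p ∈ kasnerArc v β := by
  obtain ⟨β, hβ⟩ := exists_mem_arc hv (bianchiIIMap_mem hv hp hα)
  refine ⟨β, ?_, hβ⟩
  rintro rfl
  exact bianchiIIMap_notMem_arc hv (coord_lt hv hp hα) hβ

theorem mem_of_kasnerMap_mem (hv : v ∈ Ioo (1 / 2 : ℝ) 1) (hp : p.1 α < -2 * v)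
    (h : kasnerMap v p ∈ infiniteChainSet v) : p ∈ infiniteChainSet v := by
  rw [mem_infiniteChainSet_iff hv] at h ⊢
  rintro (_ | n)
  exacts [⟨α, hp⟩, h n]

/-- These are the inverse branches of the Kasner map on C: they prepend the letter α to an
itinerary. -/
theorem bianchiIIMap_mem_of_notMem_arc (hv : v ∈ Ioo (1 / 2 : ℝ) 1)
    (hp : p ∈ infiniteChainSet v) (hα : p ∉ kasnerArc v α) :
    bianchiIIMap v α p ∈ infiniteChainSet v :=
  mem_of_kasnerMap_mem hv (bianchiIIMap_apply_self_lt hv hα) (by rwa [kasnerMap_bianchiIIMap hv hα])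

/-! ### Expansion bounds -/

/-- The image has coordinate α above -1, and its factor is the reciprocal. This crude rate above 1
only serves to prove `coord_le_inv`. -/
theorem le_factor_of_bianchiIIMap_mem_arc (hv : v ∈ Ioo (1 / 2 : ℝ) 1) (hβ : β ≠ α)
    (h : bianchiIIMap v α p ∈ kasnerArc v β) :
    (1 + v ^ 2 - v) / (1 - v ^ 2) ≤ factor v α p := by
  have h1 := factor_mul_denom hv (bianchiIIMap v α p) α
  have h2 := neg_one_lt_coord hv.1 h hβ.symm
  have hg := factor_pos hv p α
  rw [factor_bianchiIIMap hv] at h1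
  rw [div_le_iff₀ (one_sub_sq_pos hv), ← h1, mul_inv_cancel_left₀ hg.ne']
  nlinarith [hv.1]

/-- A step in an arc α ≠ γ multiplies p_γ - 1/v by g. If this difference is positive, p_γ > 0
excludes the arc γ at every step, so the difference grows geometrically, against p_γ ≤ 2. -/
theorem coord_le_inv (hv : v ∈ Ioo (1 / 2 : ℝ) 1) (hp : p ∈ infiniteChainSet v) (γ : Fin 3) :
    p.1 γ ≤ v⁻¹ := by
  have hv0 : 0 < v := by linarith [hv.1]
  by_contra! hlt
  set c := (1 + v ^ 2 - v) / (1 - v ^ 2) with hc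
  have hc1 : 1 < c := by
    rw [hc, one_lt_div (one_sub_sq_pos hv)]
    nlinarith [hv.1]
  have key : ∀ n : ℕ, ∃ q ∈ infiniteChainSet v, c ^ n * (p.1 γ - v⁻¹) ≤ q.1 γ - v⁻¹ := by
    intro n
    induction n with
    | zero => exact ⟨p, hp, by simp⟩
    | succ n ih =>
      obtain ⟨q, hq, hle⟩ := ih
      obtain ⟨α, hα⟩ := exists_mem_arc hv hq
      obtain ⟨β, hβ, hq'⟩ := exists_bianchiIIMap_mem_arc hv hq hα
      have h0 : 0 < c ^ n * (p.1 γ - v⁻¹) := by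
        have := sub_pos.2 hlt
        positivity
      have hγ : γ ≠ α := by
        rintro rfl
        have h1 : q.1 γ ≤ -2 * v := hα
        have : 0 < v⁻¹ := inv_pos.2 hv0
        linarith
      refine ⟨_, bianchiIIMap_mem hv hq hα, ?_⟩
      have hg := le_factor_of_bianchiIIMap_mem_arc hv hβ hq'
      rw [bianchiIIMap_apply_of_ne hγ, pow_succ']
      calc c * c ^ n * (p.1 γ - v⁻¹) = c * (c ^ n * (p.1 γ - v⁻¹)) := by ring
        _ ≤ factor v α q * (q.1 γ - v⁻¹) := mul_le_mul hg hle h0.le (factor_pos hv q α).le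
        _ = _ := by ring
  obtain ⟨n, hn⟩ := pow_unbounded_of_one_lt (2 / (p.1 γ - v⁻¹)) hc1
  obtain ⟨q, -, hq⟩ := key n
  rw [div_lt_iff₀ (sub_pos.2 hlt)] at hn
  have : 0 < v⁻¹ := inv_pos.2 hv0
  linarith [(coord_mem_Icc q γ).2]

/-- The smallest expansion rate of the Kasner circle map on the set of infinite chains. -/
noncomputable def minFactor (v : ℝ) : ℝ := 2 * (1 - v ^ 2) / (1 + 2 * v ^ 2 - √(12 * v ^ 2 - 3))

/-- The upper bound of the expansion rate of the Kasner circle map on the set of infinite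
chains. -/
noncomputable def maxFactor (v : ℝ) : ℝ := (2 + v ^ 2) / (1 - v ^ 2)

theorem lt_sqrt (hv : v ∈ Ioo (1 / 2 : ℝ) 1) : 4 * v ^ 2 - 1 < √(12 * v ^ 2 - 3) := by
  have h1 := one_sub_sq_pos hv
  have h2 : 0 < 4 * v ^ 2 - 1 := by nlinarith [hv.1]
  rw [Real.lt_sqrt h2.le]
  nlinarith

theorem sqrt_lt (hv : v ∈ Ioo (1 / 2 : ℝ) 1) : √(12 * v ^ 2 - 3) < 1 + 2 * v ^ 2 := by
  have h1 := one_sub_sq_pos hv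
  rw [Real.sqrt_lt' (by positivity)]
  nlinarith

theorem one_lt_minFactor (hv : v ∈ Ioo (1 / 2 : ℝ) 1) : 1 < minFactor v := by
  rw [minFactor, one_lt_div (by linarith [sqrt_lt hv])]
  linarith [lt_sqrt hv]

theorem one_lt_maxFactor (hv : v ∈ Ioo (1 / 2 : ℝ) 1) : 1 < maxFactor v := by
  rw [maxFactor, one_lt_div (one_sub_sq_pos hv)]
  nlinarith [hv.1]

/-- For the other two coordinates, (1 - v p_β)(1 - v p_γ) ≥ 0. Since p_β + p_γ = -p_α and p_β p_γ =
p_α² - 3, this reads x² + x + 1 - 3v² ≥ 0 with x = v p_α. As x < -2v² < -1/2, x lies below the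
smaller root. -/
theorem coord_mul_le (hv : v ∈ Ioo (1 / 2 : ℝ) 1) (hp : p ∈ infiniteChainSet v)
    (hα : p ∈ kasnerArc v α) : 2 * (p.1 α * v) ≤ -1 - √(12 * v ^ 2 - 3) := by
  have hv0 : 0 < v := by linarith [hv.1]
  have hb : ∀ γ, 0 ≤ 1 - v * p.1 γ := fun γ => by
    have := mul_le_mul_of_nonneg_left (coord_le_inv hv hp γ) hv0.le
    rw [mul_inv_cancel₀ hv0.ne'] at this
    linarith
  have h1 : α ≠ α + 1 := by fin_cases α <;> decide
  have h2 : α ≠ α + 2 := by fin_cases α <;> decide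
  have h3 : α + 1 ≠ α + 2 := by fin_cases α <;> decide
  have hs := coord_add_add p h1 h2 h3
  have hr := coord_rel p h1
  have hm := mul_nonneg (hb (α + 1)) (hb (α + 2))
  have hlt := coord_lt hv hp hα
  have h2 : p.1 (α + 2) = -p.1 α - p.1 (α + 1) := by linarith
  rw [h2] at hm
  suffices √(12 * v ^ 2 - 3) ≤ -(2 * (p.1 α * v) + 1) by linarith
  rw [Real.sqrt_le_iff]
  constructor
  · nlinarith [hv.1]
  · have h5 : v ^ 2 * (p.1 α ^ 2 + p.1 α * p.1 (α + 1) + p.1 (α + 1) ^ 2) = v ^ 2 * 3 := by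
      rw [hr]
    linarith

theorem minFactor_le_factor (hv : v ∈ Ioo (1 / 2 : ℝ) 1) (hp : p ∈ infiniteChainSet v)
    (hα : p ∈ kasnerArc v α) : minFactor v ≤ factor v α p := by
  have h1 := coord_mul_le hv hp hα
  have h2 := factor_denom_pos hv p α
  have h3 := sqrt_lt hv
  have h4 := one_sub_sq_pos hv
  rw [minFactor, factor, kasnerFactor, div_le_div_iff₀ (by linarith) h2]
  nlinarith

/-- The factor at the image is the reciprocal, and the image lies in C, so its coordinate α is at
most 1/v. -/
theorem factor_le_maxFactor (hv : v ∈ Ioo (1 / 2 : ℝ) 1) (hp : p ∈ infiniteChainSet v)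
    (hα : p ∈ kasnerArc v α) : factor v α p ≤ maxFactor v := by
  have hv0 : 0 < v := by linarith [hv.1]
  have h1 := factor_mul_denom hv (bianchiIIMap v α p) α
  have h2 := mul_le_mul_of_nonneg_right (coord_le_inv hv (bianchiIIMap_mem hv hp hα) α) hv0.le
  rw [inv_mul_cancel₀ hv0.ne'] at h2
  have hg := factor_pos hv p α
  rw [factor_bianchiIIMap hv] at h1
  rw [maxFactor, le_div_iff₀ (one_sub_sq_pos hv), ← h1, mul_inv_cancel_left₀ hg.ne']
  linarith

theorem dist_bianchiIIMap_le (hv : v ∈ Ioo (1 / 2 : ℝ) 1) (hp : p ∈ infiniteChainSet v)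
    (hq : q ∈ infiniteChainSet v) (hpα : p ∉ kasnerArc v α) (hqα : q ∉ kasnerArc v α) :
    dist (bianchiIIMap v α p) (bianchiIIMap v α q) ≤ (minFactor v)⁻¹ * dist p q := by
  have hm := one_lt_minFactor hv
  have key : ∀ q ∈ infiniteChainSet v, q ∉ kasnerArc v α → factor v α q ≤ (minFactor v)⁻¹ := by
    intro q hq hqα
    have := minFactor_le_factor hv (bianchiIIMap_mem_of_notMem_arc hv hq hqα)
      (bianchiIIMap_mem_arc hv hqα)
    rw [factor_bianchiIIMap hv] at this
    exact (le_inv_comm₀ (by linarith) (factor_pos hv q α)).1 this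
  refine abs_le_of_sq_le_sq' ?_ (by positivity) |>.2
  rw [dist_bianchiIIMap_sq hv, mul_pow, sq (minFactor v)⁻¹]
  have h1 := key p hp hpα
  have h2 := key q hq hqα
  have h3 := factor_pos hv q α
  gcongr

theorem dist_kasnerMap_le (hv : v ∈ Ioo (1 / 2 : ℝ) 1) (hp : p ∈ infiniteChainSet v)
    (hq : q ∈ infiniteChainSet v) (hpα : p ∈ kasnerArc v α) (hqα : q ∈ kasnerArc v α) :
    dist (kasnerMap v p) (kasnerMap v q) ≤ maxFactor v * dist p q := by
  have hM := one_lt_maxFactor hv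
  rw [kasnerMap_of_mem hv.1 hpα, kasnerMap_of_mem hv.1 hqα]
  refine abs_le_of_sq_le_sq' ?_ (by positivity) |>.2
  rw [dist_bianchiIIMap_sq hv, mul_pow, sq (maxFactor v)]
  have h1 := factor_le_maxFactor hv hp hpα
  have h2 := factor_le_maxFactor hv hq hqα
  have h3 := factor_pos hv q α
  gcongr

/-! ### Topology of the set of infinite chains -/

/-- The defining inequalities are strict, but `coord_mul_le` keeps C uniformly away from the end
points of the arcs, so closed conditions describe the same set. -/
theorem isClosed_infiniteChainSet (hv : v ∈ Ioo (1 / 2 : ℝ) 1) :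
    IsClosed (infiniteChainSet v) := by
  have hv0 : 0 < v := by linarith [hv.1]
  have heq : infiniteChainSet v = ⋂ n : ℕ, ⋃ α : Fin 3,
      {p | 2 * (((kasnerMap v)^[n] p).1 α * v) ≤ -1 - √(12 * v ^ 2 - 3)} := by
    ext p
    simp only [mem_iInter, mem_iUnion]
    constructor
    · intro hp n
      have hn := iterate_kasnerMap_mem hp n
      obtain ⟨α, hα⟩ := exists_mem_arc hv hn
      exact ⟨α, coord_mul_le hv hn hα⟩
    · intro h
      rw [mem_infiniteChainSet_iff hv]
      intro n
      obtain ⟨α, hα⟩ := h n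
      refine ⟨α, ?_⟩
      have h1 := lt_sqrt hv
      have h2 : 2 * (((kasnerMap v)^[n] p).1 α * v) ≤ -1 - √(12 * v ^ 2 - 3) := hα
      by_contra! h3
      nlinarith
  rw [heq]
  refine isClosed_iInter fun n => isClosed_iUnion_of_finite fun α => isClosed_le ?_ continuous_const
  have := (continuous_coord α).comp ((continuous_kasnerMap hv).iterate n)
  exact continuous_const.mul (this.mul continuous_const)

theorem arc_nonempty (hv : v ∈ Ioo (1 / 2 : ℝ) 1) (α : Fin 3) : (kasnerArc v α).Nonempty := by
  refine ⟨⟨-taubPoint α, ?_, ?_⟩, ?_⟩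
  · fin_cases α <;> simp [taubPoint] <;> norm_num
  · fin_cases α <;> simp [taubPoint] <;> norm_num
  · simp [kasnerArc, taubPoint]
    exact hv.2.le

/-- Every itinerary without immediate repetitions is realized by an infinite chain. -/
theorem exists_itinerary (hv : v ∈ Ioo (1 / 2 : ℝ) 1) (a : ℕ → Fin 3)
    (ha : ∀ n, a n ≠ a (n + 1)) :
    ∃ p ∈ infiniteChainSet v, ∀ n, (kasnerMap v)^[n] p ∈ kasnerArc v (a n) := by
  set t : ℕ → Set kasnerCircle := fun n => {p | ∀ i ≤ n, (kasnerMap v)^[i] p ∈ kasnerArc v (a i)}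
    with ht
  have hne : ∀ n, (t n).Nonempty := by
    intro n
    simp only [ht]
    clear ht t
    induction n generalizing a with
    | zero =>
      obtain ⟨p, hp⟩ := arc_nonempty hv (a 0)
      exact ⟨p, fun i hi => by rw [Nat.le_zero.1 hi]; exact hp⟩
    | succ n ih =>
      -- Finite itineraries are built backwards: a point realizing the shifted word is pulled into
      -- the first arc.
      obtain ⟨q, hq⟩ := ih (fun i => a (i + 1)) fun i => ha (i + 1)
      have hq0 : q ∉ kasnerArc v (a 0) := notMem_arc hv.1 (hq 0 (Nat.zero_le _)) (ha 0)
      refine ⟨bianchiIIMap v (a 0) q, ?_⟩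
      rintro (_ | i) hi
      · exact bianchiIIMap_mem_arc hv hq0
      · rw [Function.iterate_succ_apply, kasnerMap_bianchiIIMap hv hq0]
        exact hq i (by omega)
  have hcl : ∀ n, IsClosed (t n) := by
    intro n
    simp only [ht, ofPred_forall]
    exact isClosed_iInter fun i => isClosed_iInter fun _ =>
      (isClosed_arc v (a i)).preimage ((continuous_kasnerMap hv).iterate i)
  obtain ⟨p, hp⟩ := IsCompact.nonempty_iInter_of_sequence_nonempty_isCompact_isClosed t
    (fun n p hp i hi => hp i (by omega)) hne (hcl 0).isCompact hcl
  have hp' : ∀ n, (kasnerMap v)^[n] p ∈ kasnerArc v (a n) := fun n => mem_iInter.1 hp n n le_rfl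
  refine ⟨p, (mem_infiniteChainSet_iff hv).2 fun n => ⟨a n, ?_⟩, hp'⟩
  -- An end point of an arc is fixed, which would repeat the letter.
  refine lt_of_le_of_ne (hp' n) fun heq => ?_
  have h := hp' (n + 1)
  rw [Function.iterate_succ_apply', kasnerMap_of_mem hv.1 (hp' n), bianchiIIMap_eq_self hv heq] at h
  exact ha n (kasnerArc_unique hv.1 (hp' n) h)

theorem exists_mem_inter_arc (hv : v ∈ Ioo (1 / 2 : ℝ) 1) (α : Fin 3) :
    ∃ p ∈ infiniteChainSet v, p ∈ kasnerArc v α := by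
  have h1 : α ≠ α + 1 := by fin_cases α <;> decide
  obtain ⟨p, hp, h⟩ := exists_itinerary hv (fun n => if Even n then α else α + 1) fun n => by
    by_cases hn : Even n
    · simp [hn, Nat.even_add_one]
    · simp [hn, Nat.even_add_one]
  exact ⟨p, hp, by simpa using h 0⟩

/-- For n = 0, a point of C in the third arc is pulled back, so its second letter differs from that
of p. Each further pullback along the itinerary of p contracts the distance. -/
theorem exists_ne_dist_le (hv : v ∈ Ioo (1 / 2 : ℝ) 1) (n : ℕ) (hp : p ∈ infiniteChainSet v)
    (hα : p ∈ kasnerArc v α) :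
    ∃ q ∈ infiniteChainSet v, q ∈ kasnerArc v α ∧ q ≠ p ∧ dist p q ≤ (minFactor v)⁻¹ ^ n * 7 := by
  induction n generalizing p α with
  | zero =>
    obtain ⟨β, hβ, hp'⟩ := exists_bianchiIIMap_mem_arc hv hp hα
    obtain ⟨γ, h1, h2⟩ : ∃ γ, γ ≠ α ∧ γ ≠ β := by
      clear hp' hα
      revert α β
      decide
    obtain ⟨q, hq, hqγ⟩ := exists_mem_inter_arc hv γ
    have hqα := notMem_arc hv.1 hqγ h1.symm
    refine ⟨bianchiIIMap v α q, bianchiIIMap_mem_of_notMem_arc hv hq hqα,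
      bianchiIIMap_mem_arc hv hqα, ?_, by simpa using dist_le _ _⟩
    rintro rfl
    rw [bianchiIIMap_involutive hv] at hp'
    exact h2 (kasnerArc_unique hv.1 hqγ hp')
  | succ n ih =>
    obtain ⟨β, hβ, hp'⟩ := exists_bianchiIIMap_mem_arc hv hp hα
    obtain ⟨q, hq, hqβ, hne, hd⟩ := ih (bianchiIIMap_mem hv hp hα) hp'
    have hqα := notMem_arc hv.1 hqβ hβ.symm
    refine ⟨bianchiIIMap v α q, bianchiIIMap_mem_of_notMem_arc hv hq hqα,
      bianchiIIMap_mem_arc hv hqα, ?_, ?_⟩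
    · rintro rfl
      exact hne (bianchiIIMap_involutive hv α q).symm
    · have h := dist_bianchiIIMap_le hv (bianchiIIMap_mem hv hp hα) hq
        (notMem_arc hv.1 hp' hβ.symm) hqα
      have hm := one_lt_minFactor hv
      rw [bianchiIIMap_involutive hv] at h
      refine h.trans ?_
      rw [pow_succ', mul_assoc]
      gcongr

theorem tendsto_inv_minFactor_pow (hv : v ∈ Ioo (1 / 2 : ℝ) 1) (c : ℝ) :
    Tendsto (fun n : ℕ => (minFactor v)⁻¹ ^ n * c) atTop (𝓝 0) := by
  have hm := one_lt_minFactor hv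
  have := tendsto_pow_atTop_nhds_zero_of_lt_one (by positivity) (inv_lt_one_of_one_lt₀ hm)
  simpa using this.mul_const c

theorem perfect_infiniteChainSet (hv : v ∈ Ioo (1 / 2 : ℝ) 1) : Perfect (infiniteChainSet v) := by
  refine ⟨isClosed_infiniteChainSet hv, fun p hp => accPt_iff_nhds.2 fun U hU => ?_⟩
  obtain ⟨ε, hε, hU⟩ := Metric.mem_nhds_iff.1 hU
  obtain ⟨n, hn⟩ := ((tendsto_inv_minFactor_pow hv 7).eventually_lt_const hε).exists
  obtain ⟨α, hα⟩ := exists_mem_arc hv hp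
  obtain ⟨q, hq, -, hne, hd⟩ := exists_ne_dist_le hv n hp hα
  exact ⟨q, ⟨hU (by rw [Metric.mem_ball, dist_comm]; exact hd.trans_lt hn), hq⟩, hne⟩

/-! ### Length on the Kasner circle -/

/-- The hypothesis makes f factor through g by a K-Lipschitz map on g(s). Taking the identity for f
or for g covers lower and upper distance bounds alike. -/
theorem hausdorffMeasure_image_le_image {X Y Z : Type*} [MetricSpace Y]
    [MeasurableSpace Y] [BorelSpace Y] [MetricSpace Z] [MeasurableSpace Z] [BorelSpace Z]
    {f : X → Y} {g : X → Z} {s : Set X} {K : ℝ≥0}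
    (h : ∀ x ∈ s, ∀ y ∈ s, dist (f x) (f y) ≤ K * dist (g x) (g y)) :
    μH[1] (f '' s) ≤ K * μH[1] (g '' s) := by
  rcases s.eq_empty_or_nonempty with rfl | ⟨x₀, hx₀⟩
  · simp
  have : Nonempty X := ⟨x₀⟩
  have hi : ∀ x ∈ s, Function.invFunOn g s (g x) ∈ s ∧ g (Function.invFunOn g s (g x)) = g x :=
    fun x hx => ⟨Function.invFunOn_mem ⟨x, hx, rfl⟩, Function.invFunOn_eq ⟨x, hx, rfl⟩⟩
  have hL : LipschitzOnWith K (f ∘ Function.invFunOn g s) (g '' s) := by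
    refine LipschitzOnWith.of_dist_le_mul ?_
    rintro _ ⟨x, hx, rfl⟩ _ ⟨y, hy, rfl⟩
    have := h _ (hi x hx).1 _ (hi y hy).1
    rwa [(hi x hx).2, (hi y hy).2] at this
  have heq : f '' s ⊆ (f ∘ Function.invFunOn g s) '' (g '' s) := by
    rintro _ ⟨x, hx, rfl⟩
    refine ⟨g x, mem_image_of_mem g hx, ?_⟩
    have := h _ (hi x hx).1 x hx
    rw [(hi x hx).2, dist_self, mul_zero] at this
    exact dist_le_zero.1 this
  calc μH[1] (f '' s) ≤ μH[1] ((f ∘ Function.invFunOn g s) '' (g '' s)) := measure_mono heq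
    _ ≤ (K : ℝ≥0∞) ^ (1 : ℝ) * μH[1] (g '' s) := hL.hausdorffMeasure_image_le zero_le_one
    _ = _ := by rw [ENNReal.rpow_one]

theorem dist_kasnerPoint_sq (a b : ℝ) :
    dist (kasnerPoint a) (kasnerPoint b) ^ 2 = 12 * (1 - Real.cos (a - b)) := by
  have h3 : √3 ^ 2 = (3 : ℝ) := Real.sq_sqrt (by norm_num)
  rw [dist_sq, Real.cos_sub]
  simp only [kasnerPoint]
  simp
  linear_combination 2 * (Real.sin a - Real.sin b) ^ 2 * h3 + 6 * Real.sin_sq_add_cos_sq a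
    + 6 * Real.sin_sq_add_cos_sq b

theorem dist_kasnerPoint_le (a b : ℝ) : dist (kasnerPoint a) (kasnerPoint b) ≤ 3 * dist a b := by
  refine abs_le_of_sq_le_sq' ?_ (by positivity) |>.2
  rw [dist_kasnerPoint_sq, mul_pow, Real.dist_eq, sq_abs]
  nlinarith [Real.one_sub_sq_div_two_le_cos (x := a - b), sq_nonneg (a - b)]

theorem le_dist_kasnerPoint {a b : ℝ} (h : |a - b| ≤ Real.pi) :
    dist a b ≤ dist (kasnerPoint a) (kasnerPoint b) := by
  refine abs_le_of_sq_le_sq' ?_ (by positivity) |>.2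
  rw [dist_kasnerPoint_sq, Real.dist_eq, sq_abs]
  have h1 := Real.cos_le_one_sub_mul_cos_sq h
  have h2 : 1 ≤ 12 * (2 / Real.pi ^ 2) := by
    rw [← mul_div_assoc, one_le_div (by positivity)]
    nlinarith [Real.pi_pos, Real.pi_lt_four]
  nlinarith [sq_nonneg (a - b)]

/-- Chords dominate parameter distance only up to distance π, so the circle is cut into two halves;
hence the factor 2. -/
theorem kasnerLength_le {s : Set kasnerCircle} (hs : MeasurableSet s) :
    kasnerLength s ≤ 2 * μH[1] s := by
  have key : ∀ t : Set ℝ, (∀ a ∈ t, ∀ b ∈ t, |a - b| ≤ Real.pi) →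
      volume (kasnerPoint ⁻¹' s ∩ t) ≤ μH[1] s := by
    intro t ht
    have h := hausdorffMeasure_image_le_image (f := (id : ℝ → ℝ)) (g := kasnerPoint)
      (s := kasnerPoint ⁻¹' s ∩ t) (K := 1)
      fun a ha b hb => by simpa using le_dist_kasnerPoint (ht a ha.2 b hb.2)
    rw [image_id, hausdorffMeasure_real, ENNReal.coe_one, one_mul] at h
    refine h.trans (measure_mono ?_)
    rintro _ ⟨a, ha, rfl⟩
    exact ha.1
  rw [kasnerLength, Measure.map_apply continuous_kasnerPoint.measurable hs,
    Measure.restrict_apply (continuous_kasnerPoint.measurable hs),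
    ← Ioc_union_Ioc_eq_Ioc (neg_nonpos.2 Real.pi_pos.le) Real.pi_pos.le, inter_union_distrib_left,
    two_mul]
  refine (measure_union_le _ _).trans (add_le_add (key _ ?_) (key _ ?_)) <;>
  · intro a ha b hb
    rw [abs_le]
    constructor <;> linarith [ha.1, ha.2, hb.1, hb.2]

theorem kasnerLength_pos {s : Set kasnerCircle} (hs : IsOpen s) (hne : s.Nonempty) :
    0 < kasnerLength s := by
  obtain ⟨p, hp⟩ := hne
  obtain ⟨φ, hφ, rfl⟩ := exists_kasnerPoint_eq p
  have ho := hs.preimage continuous_kasnerPoint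
  rw [kasnerLength, Measure.map_apply continuous_kasnerPoint.measurable hs.measurableSet,
    Measure.restrict_apply ho.measurableSet]
  -- The parameter may be π itself, which the open interval misses.
  have hcl : φ ∈ closure (Ioo (-Real.pi) Real.pi) := by
    rw [closure_Ioo (by linarith [Real.pi_pos])]
    exact Ioc_subset_Icc_self hφ
  refine ((ho.inter isOpen_Ioo).measure_pos volume ?_).trans_le
    (measure_mono (inter_subset_inter_right _ Ioo_subset_Ioc_self))
  exact mem_closure_iff.1 hcl _ ho hp

instance : IsFiniteMeasure (μH[1] : Measure kasnerCircle) := by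
  refine ⟨?_⟩
  have h := hausdorffMeasure_image_le_image (f := kasnerPoint) (g := (id : ℝ → ℝ))
    (s := Ioc (-Real.pi) Real.pi) (K := 3) fun a _ b _ => dist_kasnerPoint_le a b
  rw [image_id, hausdorffMeasure_real, Real.volume_Ioc] at h
  have hu : kasnerPoint '' Ioc (-Real.pi) Real.pi = univ := eq_univ_of_forall exists_kasnerPoint_eq
  rw [hu] at h
  exact h.trans_lt (ENNReal.mul_lt_top ENNReal.coe_lt_top ENNReal.ofReal_lt_top)

theorem hausdorffMeasure_real_pos {s : Set kasnerCircle} (hs : IsOpen s) (hne : s.Nonempty) :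
    0 < (μH[1] : Measure kasnerCircle).real s := by
  refine ENNReal.toReal_pos (fun h => ?_) (measure_ne_top _ _)
  have := (kasnerLength_pos hs hne).trans_le (kasnerLength_le hs.measurableSet)
  simp [h] at this

/-! ### The set of infinite chains is null -/

/-- A Möbius-like map of the Kasner circle whose distortion on the arc `A_α` is controlled
because some point of another arc has its image far from the image of `A_α`. -/
structure IsControlled (v : ℝ) (α : Fin 3) (Φ : kasnerCircle → kasnerCircle) : Prop where
  continuous : Continuous Φ
  exists_scale : ∃ ρ : kasnerCircle → ℝ, (∀ p, 0 < ρ p) ∧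
    ∀ p q, dist (Φ p) (Φ q) ^ 2 = ρ p * ρ q * dist p q ^ 2
  exists_far : ∃ β, β ≠ α ∧ ∃ z ∈ kasnerArc v β, ∀ p ∈ kasnerArc v α, 2 * v - 1 ≤ dist (Φ z) (Φ p)

theorem IsControlled.injective {Φ : kasnerCircle → kasnerCircle} (h : IsControlled v α Φ) :
    Function.Injective Φ := by
  obtain ⟨ρ, hρ, hd⟩ := h.exists_scale
  intro p q hpq
  have := hd p q
  rw [hpq, dist_self, zero_pow two_ne_zero, eq_comm, mul_eq_zero,
    or_iff_right (mul_pos (hρ p) (hρ q)).ne'] at this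
  exact dist_eq_zero.1 (pow_eq_zero_iff two_ne_zero |>.1 this)

theorem isControlled_id (hv : v ∈ Ioo (1 / 2 : ℝ) 1) (α : Fin 3) : IsControlled v α id := by
  have h : α + 1 ≠ α := by fin_cases α <;> decide
  obtain ⟨z, hz⟩ := arc_nonempty hv (α + 1)
  exact ⟨continuous_id, ⟨fun _ => 1, fun _ => one_pos, fun p q => by simp⟩,
    α + 1, h, z, hz, fun p hp => le_dist_of_mem_arc hv.1 hz hp h⟩

theorem IsControlled.comp (hv : v ∈ Ioo (1 / 2 : ℝ) 1) {Φ : kasnerCircle → kasnerCircle}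
    (h : IsControlled v α Φ) (hβ : β ≠ α) : IsControlled v β (Φ ∘ bianchiIIMap v α) := by
  obtain ⟨ρ, hρ, hd⟩ := h.exists_scale
  obtain ⟨γ, hγ, z, hz, hfar⟩ := h.exists_far
  refine ⟨h.continuous.comp (continuous_bianchiIIMap hv α),
    ⟨fun p => ρ (bianchiIIMap v α p) * factor v α p, fun p => mul_pos (hρ _) (factor_pos hv p α),
      fun p q => ?_⟩,
    -- The new far point has the same image Φ(z) by involutivity, and A_β is carried into A_α, where
    -- the old bound applies.
    α, hβ.symm, bianchiIIMap v α z, bianchiIIMap_mem_arc hv (notMem_arc hv.1 hz hγ.symm),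
    fun p hp => ?_⟩
  · rw [Function.comp_apply, Function.comp_apply, hd, dist_bianchiIIMap_sq hv]
    ring
  · rw [Function.comp_apply, Function.comp_apply, bianchiIIMap_involutive hv]
    exact hfar _ (bianchiIIMap_mem_arc hv (notMem_arc hv.1 hp hβ.symm))

/-- The bound for the distortion of controlled maps. -/
noncomputable def distortion (v : ℝ) : ℝ := 49 / (2 * v - 1) ^ 2

theorem one_le_distortion (hv : v ∈ Ioo (1 / 2 : ℝ) 1) : 1 ≤ distortion v := by
  have h1 : 0 < 2 * v - 1 := by linarith [hv.1]
  rw [distortion, one_le_div (by positivity)]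
  nlinarith [hv.2]

/-- The product ρ(z)ρ(p) is a quotient of squared distances that all lie between (2v-1)² and 49. So
ρ is comparable on A_α to the constant t = 1/ρ(z). -/
theorem IsControlled.exists_dist_le (hv : v ∈ Ioo (1 / 2 : ℝ) 1)
    {Φ : kasnerCircle → kasnerCircle} (h : IsControlled v α Φ) :
    ∃ t : ℝ, 0 < t ∧ ∀ p ∈ kasnerArc v α, ∀ q ∈ kasnerArc v α,
      dist (Φ p) (Φ q) ≤ distortion v * t * dist p q ∧
      dist p q ≤ distortion v * t⁻¹ * dist (Φ p) (Φ q) := by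
  obtain ⟨ρ, hρ, hd⟩ := h.exists_scale
  obtain ⟨γ, hγ, z, hz, hfar⟩ := h.exists_far
  have hδ : 0 < 2 * v - 1 := by linarith [hv.1]
  have hz0 := hρ z
  have hup : ∀ p ∈ kasnerArc v α, ρ p ≤ distortion v * (ρ z)⁻¹ := by
    intro p hp
    have h1 := hd z p
    have h2 := le_dist_of_mem_arc hv.1 hz hp hγ
    have h3 := dist_le (Φ z) (Φ p)
    have h4 : dist (Φ z) (Φ p) ^ 2 ≤ 7 ^ 2 := by gcongr
    have h5 : (2 * v - 1) ^ 2 ≤ dist z p ^ 2 := by gcongr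
    rw [distortion, ← div_eq_mul_inv, div_div, le_div_iff₀ (by positivity)]
    have := mul_le_mul_of_nonneg_left h5 (mul_pos hz0 (hρ p)).le
    linarith
  have hlow : ∀ p ∈ kasnerArc v α, (ρ p)⁻¹ ≤ distortion v * ρ z := by
    intro p hp
    have h1 := hd z p
    have h2 := hfar p hp
    have h3 := dist_le z p
    have h4 : dist z p ^ 2 ≤ 7 ^ 2 := by gcongr
    have h5 : (2 * v - 1) ^ 2 ≤ dist (Φ z) (Φ p) ^ 2 := by gcongr
    have h6 := hρ p
    rw [distortion, inv_le_iff_one_le_mul₀ h6, div_mul_eq_mul_div, div_mul_eq_mul_div,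
      one_le_div (by positivity)]
    have := mul_le_mul_of_nonneg_left h4 (mul_pos hz0 (hρ p)).le
    linarith
  have hκ : 0 < distortion v := one_pos.trans_le (one_le_distortion hv)
  refine ⟨(ρ z)⁻¹, inv_pos.2 hz0, fun p hp q hq => ⟨?_, ?_⟩⟩
  · refine abs_le_of_sq_le_sq' ?_ (by positivity) |>.2
    rw [hd, mul_pow, sq (distortion v * _)]
    have h1 := hup p hp
    have h2 := hup q hq
    have h3 := hρ q
    gcongr
  · refine abs_le_of_sq_le_sq' ?_ (by positivity) |>.2
    rw [mul_pow, hd, sq (distortion v * _), inv_inv, ← mul_assoc]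
    have h1 := hlow p hp
    have h2 := hlow q hq
    have h3 := hρ p
    have h4 := hρ q
    calc dist p q ^ 2 = (ρ p)⁻¹ * (ρ q)⁻¹ * (ρ p * ρ q) * dist p q ^ 2 := by field_simp
      _ ≤ _ := by gcongr

/-- The unknown scale t cancels between the upper bound for the arc and the lower bound for s, so
relative lengths are preserved up to a constant independent of Φ. -/
theorem IsControlled.measure_image_mul_le (hv : v ∈ Ioo (1 / 2 : ℝ) 1)
    {Φ : kasnerCircle → kasnerCircle} (h : IsControlled v α Φ) {s : Set kasnerCircle}
    (hs : s ⊆ kasnerArc v α) :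
    (μH[1] : Measure kasnerCircle).real (Φ '' kasnerArc v α) * (μH[1] : Measure _).real s ≤
      distortion v ^ 2 * (μH[1] : Measure kasnerCircle).real univ *
        (μH[1] : Measure kasnerCircle).real (Φ '' s) := by
  obtain ⟨t, ht, hd⟩ := h.exists_dist_le hv
  have hκ : 0 < distortion v := one_pos.trans_le (one_le_distortion hv)
  have h1 : (μH[1] : Measure kasnerCircle).real (Φ '' kasnerArc v α) ≤
      distortion v * t * (μH[1] : Measure kasnerCircle).real (kasnerArc v α) := by
    have := hausdorffMeasure_image_le_image (f := Φ) (g := (id : kasnerCircle → kasnerCircle))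
      (s := kasnerArc v α) (K := ⟨distortion v * t, by positivity⟩)
      fun p hp q hq => (hd p hp q hq).1
    rw [image_id] at this
    have := ENNReal.toReal_mono (ENNReal.mul_ne_top ENNReal.coe_ne_top (measure_ne_top _ _)) this
    rwa [ENNReal.toReal_mul] at this
  have h2 : (μH[1] : Measure kasnerCircle).real s ≤
      distortion v * t⁻¹ * (μH[1] : Measure kasnerCircle).real (Φ '' s) := by
    have := hausdorffMeasure_image_le_image (f := (id : kasnerCircle → kasnerCircle)) (g := Φ)
      (s := s) (K := ⟨distortion v * t⁻¹, by positivity⟩)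
      fun p hp q hq => (hd p (hs hp) q (hs hq)).2
    rw [image_id] at this
    have := ENNReal.toReal_mono (ENNReal.mul_ne_top ENNReal.coe_ne_top (measure_ne_top _ _)) this
    rwa [ENNReal.toReal_mul] at this
  have h3 : (μH[1] : Measure kasnerCircle).real (kasnerArc v α) ≤
      (μH[1] : Measure kasnerCircle).real univ := measureReal_mono (subset_univ _)
  calc _ ≤ (distortion v * t * (μH[1] : Measure kasnerCircle).real univ) *
        (distortion v * t⁻¹ * (μH[1] : Measure kasnerCircle).real (Φ '' s)) := by
          gcongr
          exact h1.trans (by gcongr)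
    _ = _ := by field_simp

/-- The complement of the three arcs. -/
def gap (v : ℝ) : Set kasnerCircle := (⋃ α, kasnerArc v α)ᶜ

theorem isOpen_gap (v : ℝ) : IsOpen (gap v) :=
  (isClosed_iUnion_of_finite (isClosed_arc v)).isOpen_compl

theorem notMem_arc_of_mem_gap (hp : p ∈ gap v) (α : Fin 3) : p ∉ kasnerArc v α :=
  fun h => hp (mem_iUnion.2 ⟨α, h⟩)

theorem gap_nonempty (hv : v ∈ Ioo (1 / 2 : ℝ) 1) : (gap v).Nonempty := by
  refine ⟨⟨taubPoint 0, ?_, ?_⟩, ?_⟩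
  · simp [taubPoint]; norm_num
  · simp [taubPoint]; norm_num
  · simp only [gap, mem_compl_iff, mem_iUnion, not_exists]
    intro α
    have := hv.1
    fin_cases α <;> simp [kasnerArc, taubPoint] <;> linarith

theorem isOpen_image_gap (hv : v ∈ Ioo (1 / 2 : ℝ) 1) (α : Fin 3) :
    IsOpen (bianchiIIMap v α '' gap v) := by
  rw [image_eq_preimage_of_inverse (bianchiIIMap_involutive hv α) (bianchiIIMap_involutive hv α)]
  exact (isOpen_gap v).preimage (continuous_bianchiIIMap hv α)

theorem exists_mul_measure_le (hv : v ∈ Ioo (1 / 2 : ℝ) 1) :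
    ∃ c : ℝ, 0 < c ∧ c ≤ 1 ∧ ∀ α Φ, IsControlled v α Φ →
      c * (μH[1] : Measure kasnerCircle).real (Φ '' kasnerArc v α) ≤
        (μH[1] : Measure kasnerCircle).real (Φ '' (bianchiIIMap v α '' gap v)) := by
  have hκ := one_le_distortion hv
  set m : Fin 3 → ℝ := fun α => (μH[1] : Measure kasnerCircle).real (bianchiIIMap v α '' gap v)
    with hm
  have hm0 : ∀ α, 0 < m α := fun α =>
    hausdorffMeasure_real_pos (isOpen_image_gap hv α) ((gap_nonempty hv).image _)
  set u := (μH[1] : Measure kasnerCircle).real univ with hu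
  have hmu : ∀ α, m α ≤ u := fun α => measureReal_mono (subset_univ _)
  have hu0 : 0 < u := (hm0 0).trans_le (hmu 0)
  obtain ⟨α₀, hα₀⟩ := Finite.exists_min m
  refine ⟨m α₀ / (distortion v ^ 2 * u), div_pos (hm0 α₀) (by positivity), ?_, ?_⟩
  · rw [div_le_one (by positivity)]
    nlinarith [hmu α₀, mul_le_mul_of_nonneg_right (one_le_pow₀ hκ (n := 2)) hu0.le]
  · intro α Φ h
    have hs : bianchiIIMap v α '' gap v ⊆ kasnerArc v α := by
      rintro _ ⟨p, hp, rfl⟩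
      exact bianchiIIMap_mem_arc hv (notMem_arc_of_mem_gap hp α)
    rw [div_mul_eq_mul_div, div_le_iff₀ (by positivity)]
    have h1 := h.measure_image_mul_le hv hs
    have h2 := mul_le_mul_of_nonneg_right (hα₀ α)
      (measureReal_nonneg (μ := (μH[1] : Measure kasnerCircle)) (s := Φ '' kasnerArc v α))
    linarith

theorem inter_arc_subset (hv : v ∈ Ioo (1 / 2 : ℝ) 1) (α : Fin 3) :
    infiniteChainSet v ∩ kasnerArc v α ⊆
      bianchiIIMap v α '' (infiniteChainSet v ∩ kasnerArc v (α + 1)) ∪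
        bianchiIIMap v α '' (infiniteChainSet v ∩ kasnerArc v (α + 2)) := by
  rintro p ⟨hp, hα⟩
  obtain ⟨β, hβ, hp'⟩ := exists_bianchiIIMap_mem_arc hv hp hα
  have hC := bianchiIIMap_mem hv hp hα
  have h12 : β = α + 1 ∨ β = α + 2 := by
    clear hC hp' hα
    revert α β
    decide
  have hinv := bianchiIIMap_involutive hv α p
  rcases h12 with rfl | rfl
  exacts [Or.inl ⟨_, ⟨hC, hp'⟩, hinv⟩, Or.inr ⟨_, ⟨hC, hp'⟩, hinv⟩]

theorem IsControlled.measure_image_add_le (hv : v ∈ Ioo (1 / 2 : ℝ) 1)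
    {Φ : kasnerCircle → kasnerCircle} (h : IsControlled v α Φ) :
    (μH[1] : Measure kasnerCircle).real (Φ '' (bianchiIIMap v α '' gap v)) +
      (μH[1] : Measure kasnerCircle).real (Φ '' (bianchiIIMap v α '' kasnerArc v (α + 1))) +
      (μH[1] : Measure kasnerCircle).real (Φ '' (bianchiIIMap v α '' kasnerArc v (α + 2))) ≤
      (μH[1] : Measure kasnerCircle).real (Φ '' kasnerArc v α) := by
  have h1 : α ≠ α + 1 := by fin_cases α <;> decide
  have h2 : α ≠ α + 2 := by fin_cases α <;> decide
  have h3 : α + 1 ≠ α + 2 := by fin_cases α <;> decide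
  have hinj := h.injective.comp (bianchiIIMap_involutive hv α).injective
  have hcont := h.continuous.comp (continuous_bianchiIIMap hv α)
  have hmeas : ∀ β, MeasurableSet ((Φ ∘ bianchiIIMap v α) '' kasnerArc v β) := fun β =>
    ((isClosed_arc v β).isCompact.image hcont).measurableSet
  simp only [← image_comp]
  rw [← measureReal_union _ (hmeas _), ← measureReal_union _ (hmeas _)]
  · refine measureReal_mono ?_
    rw [← image_union, ← image_union, image_comp]
    refine image_mono ?_
    rintro _ ⟨p, (hp | hp) | hp, rfl⟩
    · exact bianchiIIMap_mem_arc hv (notMem_arc_of_mem_gap hp α)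
    · exact bianchiIIMap_mem_arc hv (notMem_arc hv.1 hp h1)
    · exact bianchiIIMap_mem_arc hv (notMem_arc hv.1 hp h2)
  · rw [← image_union]
    refine (disjoint_image_iff hinj).2 (disjoint_left.2 ?_)
    rintro p (hp | hp)
    exacts [notMem_arc_of_mem_gap hp _, notMem_arc hv.1 hp h3.symm]
  · exact (disjoint_image_iff hinj).2 (disjoint_left.2 fun p hp => notMem_arc_of_mem_gap hp _)

/-- The induction treats all controlled maps at once: splitting C ∩ A_α absorbs one more inverse
branch into Φ, and the gap leaves at most the proportion 1 - c. -/
theorem hausdorffMeasure_infiniteChainSet (hv : v ∈ Ioo (1 / 2 : ℝ) 1) :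
    (μH[1] : Measure kasnerCircle) (infiniteChainSet v) = 0 := by
  obtain ⟨c, hc0, hc1, hc⟩ := exists_mul_measure_le hv
  have key : ∀ n : ℕ, ∀ α Φ, IsControlled v α Φ →
      (μH[1] : Measure kasnerCircle).real (Φ '' (infiniteChainSet v ∩ kasnerArc v α)) ≤
        (1 - c) ^ n * (μH[1] : Measure kasnerCircle).real (Φ '' kasnerArc v α) := by
    intro n
    induction n with
    | zero =>
      intro α Φ _
      rw [pow_zero, one_mul]
      exact measureReal_mono (image_mono inter_subset_right)
    | succ n ih =>
      intro α Φ h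
      have h1 : α ≠ α + 1 := by fin_cases α <;> decide
      have h2 : α ≠ α + 2 := by fin_cases α <;> decide
      have i1 := ih _ _ (h.comp hv h1.symm)
      have i2 := ih _ _ (h.comp hv h2.symm)
      simp only [image_comp] at i1 i2
      have h3 : (μH[1] : Measure kasnerCircle).real
          (Φ '' (infiniteChainSet v ∩ kasnerArc v α)) ≤ _ :=
        measureReal_mono (image_mono (inter_arc_subset hv α))
      rw [image_union] at h3
      have h4 := h3.trans (measureReal_union_le _ _)
      have h5 := h.measure_image_add_le hv
      have h6 := hc α Φ h
      have h7 : 0 ≤ (1 - c) ^ n := pow_nonneg (by linarith) n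
      refine h4.trans ((add_le_add i1 i2).trans ?_)
      rw [← mul_add, pow_succ, mul_assoc]
      exact mul_le_mul_of_nonneg_left (by linarith) h7
  have hz : ∀ α, (μH[1] : Measure kasnerCircle) (infiniteChainSet v ∩ kasnerArc v α) = 0 := by
    intro α
    rw [← measureReal_eq_zero_iff]
    refine le_antisymm ?_ measureReal_nonneg
    have ht := (tendsto_pow_atTop_nhds_zero_of_lt_one (by linarith : 0 ≤ 1 - c)
      (by linarith)).mul_const ((μH[1] : Measure kasnerCircle).real (kasnerArc v α))
    rw [zero_mul] at ht
    refine ge_of_tendsto' ht fun n => ?_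
    simpa using key n α id (isControlled_id hv α)
  refine measure_mono_null (fun p hp => ?_) (measure_iUnion_null hz)
  obtain ⟨α, hα⟩ := exists_mem_arc hv hp
  exact mem_iUnion.2 ⟨α, hp, hα⟩

theorem kasnerLength_infiniteChainSet (hv : v ∈ Ioo (1 / 2 : ℝ) 1) :
    kasnerLength (infiniteChainSet v) = 0 := by
  have := kasnerLength_le (isClosed_infiniteChainSet hv).measurableSet
  rwa [hausdorffMeasure_infiniteChainSet hv, mul_zero, nonpos_iff_eq_zero] at this

theorem isCantorSet_infiniteChainSet (hv : v ∈ Ioo (1 / 2 : ℝ) 1) :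
    IsCantorSet (infiniteChainSet v) := by
  obtain ⟨p, hp, -⟩ := exists_mem_inter_arc hv 0
  refine ⟨⟨p, hp⟩, perfect_infiniteChainSet hv, ?_⟩
  rw [IsNowhereDense, (isClosed_infiniteChainSet hv).closure_eq]
  by_contra hne
  refine (kasnerLength_pos isOpen_interior (nonempty_iff_ne_empty.2 hne)).ne' ?_
  exact measure_mono_null interior_subset (kasnerLength_infiniteChainSet hv)

/-! ### Upper bound for the Hausdorff dimension -/

theorem rpow_log_div_log {m : ℝ} (hm : 1 < m) : m ^ (Real.log 2 / Real.log m) = 2 := by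
  rw [Real.rpow_def_of_pos (by linarith), mul_div_cancel₀ _ (Real.log_pos hm).ne',
    Real.exp_log two_pos]

open Classical in
theorem exists_cover (hv : v ∈ Ioo (1 / 2 : ℝ) 1) (n : ℕ) (α : Fin 3) :
    ∃ F : Finset (Set kasnerCircle), F.card ≤ 2 ^ n ∧
      infiniteChainSet v ∩ kasnerArc v α ⊆ ⋃ t ∈ F, t ∧
      ∀ t ∈ F, t ⊆ infiniteChainSet v ∩ kasnerArc v α ∧
        ∀ p ∈ t, ∀ q ∈ t, dist p q ≤ (minFactor v)⁻¹ ^ n * 7 := by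
  induction n generalizing α with
  | zero =>
    exact ⟨{infiniteChainSet v ∩ kasnerArc v α}, by simp, by simp, by simp [dist_le]⟩
  | succ n ih =>
    have hm := one_lt_minFactor hv
    have step : ∀ β, α ≠ β → ∀ t, t ⊆ infiniteChainSet v ∩ kasnerArc v β →
        (∀ p ∈ t, ∀ q ∈ t, dist p q ≤ (minFactor v)⁻¹ ^ n * 7) →
        bianchiIIMap v α '' t ⊆ infiniteChainSet v ∩ kasnerArc v α ∧
        ∀ p ∈ bianchiIIMap v α '' t, ∀ q ∈ bianchiIIMap v α '' t,
          dist p q ≤ (minFactor v)⁻¹ ^ (n + 1) * 7 := by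
      intro β hβ t ht hd
      have hn : ∀ p ∈ t, p ∉ kasnerArc v α := fun p hp => notMem_arc hv.1 (ht hp).2 hβ
      constructor
      · rintro _ ⟨p, hp, rfl⟩
        exact ⟨bianchiIIMap_mem_of_notMem_arc hv (ht hp).1 (hn p hp),
          bianchiIIMap_mem_arc hv (hn p hp)⟩
      · rintro _ ⟨p, hp, rfl⟩ _ ⟨q, hq, rfl⟩
        refine (dist_bianchiIIMap_le hv (ht hp).1 (ht hq).1 (hn p hp) (hn q hq)).trans ?_
        rw [pow_succ', mul_assoc]
        have := hd p hp q hq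
        gcongr
    have h1 : α ≠ α + 1 := by fin_cases α <;> decide
    have h2 : α ≠ α + 2 := by fin_cases α <;> decide
    obtain ⟨F, hFc, hF, hFt⟩ := ih (α + 1)
    obtain ⟨G, hGc, hG, hGt⟩ := ih (α + 2)
    refine ⟨F.image (bianchiIIMap v α '' ·) ∪ G.image (bianchiIIMap v α '' ·), ?_, ?_, ?_⟩
    · calc _ ≤ _ := Finset.card_union_le _ _
        _ ≤ 2 ^ n + 2 ^ n :=
          add_le_add (Finset.card_image_le.trans hFc) (Finset.card_image_le.trans hGc)
        _ = 2 ^ (n + 1) := by ring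
    · intro p hp
      rcases inter_arc_subset hv α hp with ⟨q, hq, rfl⟩ | ⟨q, hq, rfl⟩
      · obtain ⟨t, ht, hqt⟩ := mem_iUnion₂.1 (hF hq)
        exact mem_iUnion₂.2 ⟨_, Finset.mem_union_left _ (Finset.mem_image_of_mem _ ht),
          mem_image_of_mem _ hqt⟩
      · obtain ⟨t, ht, hqt⟩ := mem_iUnion₂.1 (hG hq)
        exact mem_iUnion₂.2 ⟨_, Finset.mem_union_right _ (Finset.mem_image_of_mem _ ht),
          mem_image_of_mem _ hqt⟩
    · intro t ht
      rcases Finset.mem_union.1 ht with ht | ht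
      · obtain ⟨u, hu, rfl⟩ := Finset.mem_image.1 ht
        exact step _ h1 u (hFt u hu).1 (hFt u hu).2
      · obtain ⟨u, hu, rfl⟩ := Finset.mem_image.1 ht
        exact step _ h2 u (hGt u hu).1 (hGt u hu).2

theorem dimH_inter_arc_le (hv : v ∈ Ioo (1 / 2 : ℝ) 1) (α : Fin 3) :
    dimH (infiniteChainSet v ∩ kasnerArc v α) ≤
      ENNReal.ofReal (Real.log 2 / Real.log (minFactor v)) := by
  have hm := one_lt_minFactor hv
  have hm0 : 0 < minFactor v := by linarith
  set d := Real.log 2 / Real.log (minFactor v) with hd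
  have hd0 : 0 ≤ d := div_nonneg (Real.log_nonneg one_le_two) (Real.log_nonneg hm.le)
  choose F hFc hF hFt using fun n => exists_cover hv n α
  have hr : Tendsto (fun n : ℕ => ENNReal.ofReal ((minFactor v)⁻¹ ^ n * 7)) atTop (𝓝 0) := by
    simpa using ENNReal.tendsto_ofReal (tendsto_inv_minFactor_pow hv 7)
  have hdiam : ∀ n, ∀ t : F n, Metric.ediam (t : Set kasnerCircle) ≤
      ENNReal.ofReal ((minFactor v)⁻¹ ^ n * 7) := fun n t =>
    Metric.ediam_le_of_forall_dist_le (hFt n t t.2).2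
  have h := Measure.hausdorffMeasure_le_liminf_sum d (infiniteChainSet v ∩ kasnerArc v α) _ hr
    (fun n (t : F n) => (t : Set kasnerCircle)) (Eventually.of_forall hdiam)
    (Eventually.of_forall fun n => by simpa [iUnion_subtype] using hF n)
  -- Since m^d = 2, the 2^n sets contribute exactly cancelling powers.
  have hsum : ∀ n, ∑ t : F n, Metric.ediam (t : Set kasnerCircle) ^ d ≤
      ENNReal.ofReal (7 ^ d) := by
    intro n
    calc ∑ t : F n, Metric.ediam (t : Set kasnerCircle) ^ d
        ≤ ∑ _t : F n, ENNReal.ofReal ((minFactor v)⁻¹ ^ n * 7) ^ d := by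
          gcongr with t; exact hdiam n t
      _ = ((F n).card : ℝ≥0∞) * ENNReal.ofReal (((minFactor v)⁻¹ ^ n * 7) ^ d) := by
          rw [ENNReal.ofReal_rpow_of_nonneg (by positivity) hd0]
          simp
      _ ≤ (2 ^ n : ℕ) * ENNReal.ofReal (((minFactor v)⁻¹ ^ n * 7) ^ d) := by
          gcongr; exact hFc n
      _ = ENNReal.ofReal (7 ^ d) := by
          rw [← ENNReal.ofReal_natCast, ← ENNReal.ofReal_mul (by positivity),
            Real.mul_rpow (by positivity) (by positivity), ← Real.rpow_natCast, ← Real.rpow_mul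
            (by positivity), mul_comm (n : ℝ) d, Real.rpow_mul (by positivity),
            Real.inv_rpow hm0.le, hd, rpow_log_div_log hm, Real.rpow_natCast, ← mul_assoc,
            Nat.cast_pow, Nat.cast_two, ← mul_pow]
          norm_num
  have hlim : μH[d] (infiniteChainSet v ∩ kasnerArc v α) ≤ ENNReal.ofReal (7 ^ d) := by
    refine h.trans ((liminf_le_liminf (Eventually.of_forall hsum)).trans ?_)
    rw [liminf_const]
  exact dimH_le_of_hausdorffMeasure_ne_top (d := ⟨d, hd0⟩)
    (hlim.trans_lt ENNReal.ofReal_lt_top).ne |>.trans_eq (ENNReal.ofReal_eq_coe_nnreal hd0).symm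

theorem dimH_infiniteChainSet_le (hv : v ∈ Ioo (1 / 2 : ℝ) 1) :
    dimH (infiniteChainSet v) ≤ ENNReal.ofReal (Real.log 2 / Real.log (minFactor v)) := by
  have hsub : infiniteChainSet v ⊆ ⋃ α, infiniteChainSet v ∩ kasnerArc v α := fun p hp => by
    obtain ⟨α, hα⟩ := exists_mem_arc hv hp
    exact mem_iUnion.2 ⟨α, hp, hα⟩
  refine (dimH_mono hsub).trans ?_
  rw [dimH_iUnion]
  exact iSup_le (dimH_inter_arc_le hv)

theorem dimH_le_one (s : Set kasnerCircle) : dimH s ≤ 1 := by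
  have hL : LipschitzWith 3 kasnerPoint := LipschitzWith.of_dist_le_mul dist_kasnerPoint_le
  calc dimH s ≤ dimH (range kasnerPoint) := dimH_mono fun p _ => by
        obtain ⟨φ, -, h⟩ := exists_kasnerPoint_eq p
        exact ⟨φ, h⟩
    _ ≤ dimH (univ : Set ℝ) := hL.dimH_range_le
    _ = 1 := Real.dimH_univ

/-! ### Lower bound for the Hausdorff dimension -/

open Classical in
/-- The index of the arc that contains the point. -/
noncomputable def letter (v : ℝ) (p : kasnerCircle) : Fin 3 :=
  if h : ∃ α, p ∈ kasnerArc v α then h.choose else 0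

theorem letter_eq (hv : 1 / 2 < v) (h : p ∈ kasnerArc v α) : letter v p = α := by
  have h' : ∃ α, p ∈ kasnerArc v α := ⟨α, h⟩
  rw [letter, dif_pos h']
  exact kasnerArc_unique hv h'.choose_spec h

/-- The binary digits of an infinite chain: each arc is followed by one of the two others. -/
noncomputable def chainDigit (v : ℝ) (p : kasnerCircle) (n : ℕ) : Fin 2 :=
  if letter v ((kasnerMap v)^[n + 1] p) = letter v ((kasnerMap v)^[n] p) + 1 then 0 else 1

/-- The number in `[0, 1]` whose binary digits encode the itinerary of an infinite chain. -/
noncomputable def chainCode (v : ℝ) (p : kasnerCircle) : ℝ := Real.ofDigits (chainDigit v p)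

theorem Icc_subset_image_chainCode (hv : v ∈ Ioo (1 / 2 : ℝ) 1) :
    Icc 0 1 ⊆ chainCode v '' (infiniteChainSet v ∩ kasnerArc v 0) := by
  intro y hy
  obtain ⟨d, -, rfl⟩ := Real.ofDigits_SurjOn one_lt_two hy
  -- This inverts `chainDigit`: digit 0 moves to the next letter, digit 1 to the one after, starting
  -- in A_0.
  set a : ℕ → Fin 3 := fun n => Nat.rec 0 (fun n x => if d n = 0 then x + 1 else x + 2) n with ha
  have hs : ∀ n, a (n + 1) = if d n = 0 then a n + 1 else a n + 2 := fun n => rfl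
  have hne : ∀ x : Fin 3, x ≠ x + 1 ∧ x ≠ x + 2 ∧ x + 2 ≠ x + 1 := by decide
  obtain ⟨p, hp, h⟩ := exists_itinerary hv a fun n => by
    rw [hs]
    split_ifs
    exacts [(hne _).1, (hne _).2.1]
  refine ⟨p, ⟨hp, h 0⟩, congrArg Real.ofDigits (funext fun n => ?_)⟩
  rw [chainDigit, letter_eq hv.1 (h (n + 1)), letter_eq hv.1 (h n), hs]
  by_cases hd : d n = 0
  · simp [hd]
  · rw [if_neg hd, if_neg (hne _).2.2]
    exact (Fin.eq_one_of_ne_zero _ hd).symm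

theorem mem_arc_letter (hv : v ∈ Ioo (1 / 2 : ℝ) 1) (hp : p ∈ infiniteChainSet v) :
    p ∈ kasnerArc v (letter v p) := by
  obtain ⟨α, hα⟩ := exists_mem_arc hv hp
  rwa [letter_eq hv.1 hα]

theorem letter_kasnerMap_ne (hv : v ∈ Ioo (1 / 2 : ℝ) 1) (hp : p ∈ infiniteChainSet v) :
    letter v (kasnerMap v p) ≠ letter v p := by
  obtain ⟨α, hα⟩ := exists_mem_arc hv hp
  obtain ⟨β, hβ, h⟩ := exists_bianchiIIMap_mem_arc hv hp hα
  rwa [kasnerMap_of_mem hv.1 hα, letter_eq hv.1 hα, letter_eq hv.1 h]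

theorem letter_eq_and_dist_le (hv : v ∈ Ioo (1 / 2 : ℝ) 1) (hp : p ∈ infiniteChainSet v)
    (hq : q ∈ infiniteChainSet v) (hpq : letter v p = letter v q) {n : ℕ}
    (h : ∀ i < n, chainDigit v p i = chainDigit v q i) :
    letter v ((kasnerMap v)^[n] p) = letter v ((kasnerMap v)^[n] q) ∧
      dist ((kasnerMap v)^[n + 1] p) ((kasnerMap v)^[n + 1] q) ≤
        maxFactor v ^ (n + 1) * dist p q := by
  have hM := one_lt_maxFactor hv
  have step : ∀ n, letter v ((kasnerMap v)^[n] p) = letter v ((kasnerMap v)^[n] q) →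
      dist ((kasnerMap v)^[n + 1] p) ((kasnerMap v)^[n + 1] q) ≤
        maxFactor v * dist ((kasnerMap v)^[n] p) ((kasnerMap v)^[n] q) := by
    intro n hn
    have hp' := iterate_kasnerMap_mem hp n
    have hq' := iterate_kasnerMap_mem hq n
    have := mem_arc_letter hv hq'
    rw [← hn] at this
    rw [Function.iterate_succ_apply', Function.iterate_succ_apply']
    exact dist_kasnerMap_le hv hp' hq' (mem_arc_letter hv hp') this
  induction n with
  | zero => exact ⟨hpq, by simpa using step 0 hpq⟩
  | succ n ih =>
    obtain ⟨h1, h2⟩ := ih fun i hi => h i (by omega)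
    have h3 := h n (by omega)
    have hp' := letter_kasnerMap_ne hv (iterate_kasnerMap_mem hp n)
    have hq' := letter_kasnerMap_ne hv (iterate_kasnerMap_mem hq n)
    rw [← Function.iterate_succ_apply' (kasnerMap v)] at hp' hq'
    have h4 : letter v ((kasnerMap v)^[n + 1] p) = letter v ((kasnerMap v)^[n + 1] q) := by
      rw [chainDigit, chainDigit, h1] at h3
      rw [h1] at hp'
      have key : ∀ x y z : Fin 3, y ≠ x → z ≠ x →
          (if y = x + 1 then (0 : Fin 2) else 1) = (if z = x + 1 then 0 else 1) → y = z := by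
        decide
      exact key _ _ _ hp' hq' h3
    refine ⟨h4, (step _ h4).trans ?_⟩
    rw [pow_succ', mul_assoc]
    gcongr

/-- If the digits first differ at n, the points lie in different arcs after n + 1 steps, so 2v - 1 ≤
M^(n+1) dist p q. Raising to the power s, with M^s = 2, bounds 2^(-(n+1)); the codes differ by at
most 2^(-n), hence the factor 2. -/
theorem abs_chainCode_sub_le (hv : v ∈ Ioo (1 / 2 : ℝ) 1) (hp : p ∈ infiniteChainSet v)
    (hq : q ∈ infiniteChainSet v) (hpq : letter v p = letter v q) :
    |chainCode v p - chainCode v q| ≤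
      2 * (2 * v - 1)⁻¹ ^ (Real.log 2 / Real.log (maxFactor v)) *
        dist p q ^ (Real.log 2 / Real.log (maxFactor v)) := by
  have hM := one_lt_maxFactor hv
  have hδ : 0 < 2 * v - 1 := by linarith [hv.1]
  set s := Real.log 2 / Real.log (maxFactor v) with hs
  have hs0 : 0 ≤ s := div_nonneg (Real.log_nonneg one_le_two) (Real.log_nonneg hM.le)
  by_cases hex : ∃ n, chainDigit v p n ≠ chainDigit v q n
  · classical
    set n := Nat.find hex with hn
    have hlt : ∀ i < n, chainDigit v p i = chainDigit v q i := fun i hi =>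
      not_not.1 (Nat.find_min hex hi)
    obtain ⟨h1, h2⟩ := letter_eq_and_dist_le hv hp hq hpq hlt
    have h3 : letter v ((kasnerMap v)^[n + 1] p) ≠ letter v ((kasnerMap v)^[n + 1] q) := by
      intro h
      refine Nat.find_spec hex ?_
      rw [chainDigit, chainDigit, ← hn, h1, h]
    have h4 := (le_dist_of_mem_arc hv.1 (mem_arc_letter hv (iterate_kasnerMap_mem hp (n + 1)))
      (mem_arc_letter hv (iterate_kasnerMap_mem hq (n + 1))) h3).trans h2
    have h5 : 1 ≤ maxFactor v ^ (n + 1) * ((2 * v - 1)⁻¹ * dist p q) := by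
      rw [mul_left_comm, ← div_eq_inv_mul, one_le_div hδ]
      exact h4
    have h6 := Real.one_le_rpow h5 hs0
    rw [Real.mul_rpow (by positivity) (by positivity), Real.mul_rpow (by positivity)
      (by positivity), ← Real.rpow_natCast, ← Real.rpow_mul (by positivity), mul_comm _ s,
      Real.rpow_mul (by positivity), hs, rpow_log_div_log hM, ← hs, Real.rpow_natCast,
      pow_succ] at h6
    refine (Real.abs_ofDigits_sub_ofDigits_le hlt).trans ?_
    rw [inv_le_iff_one_le_mul₀ (by positivity)]
    push_cast
    linarith
  · push Not at hex
    rw [chainCode, chainCode, funext hex, sub_self, abs_zero]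
    positivity

theorem le_dimH_infiniteChainSet (hv : v ∈ Ioo (1 / 2 : ℝ) 1) :
    ENNReal.ofReal (Real.log 2 / Real.log (maxFactor v)) ≤ dimH (infiniteChainSet v) := by
  have hM := one_lt_maxFactor hv
  have hδ : 0 < 2 * v - 1 := by linarith [hv.1]
  set s := Real.log 2 / Real.log (maxFactor v) with hs
  have hs0 : 0 < s := div_pos (Real.log_pos one_lt_two) (Real.log_pos hM)
  obtain ⟨r, hr⟩ : ∃ r : ℝ≥0, (r : ℝ) = s := ⟨s.toNNReal, Real.coe_toNNReal _ hs0.le⟩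
  obtain ⟨K, hK⟩ : ∃ K : ℝ≥0, (K : ℝ) = 2 * (2 * v - 1)⁻¹ ^ s :=
    ⟨_, Real.coe_toNNReal _ (by positivity)⟩
  have hr0 : 0 < r := by rwa [← NNReal.coe_pos, hr]
  have hH : HolderOnWith K r (chainCode v) (infiniteChainSet v ∩ kasnerArc v 0) := by
    intro p hp q hq
    rw [edist_dist, edist_dist, Real.dist_eq, hr,
      ENNReal.ofReal_rpow_of_nonneg dist_nonneg hs0.le, ← ENNReal.ofReal_coe_nnreal,
      ← ENNReal.ofReal_mul K.coe_nonneg, hK]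
    refine ENNReal.ofReal_le_ofReal (abs_chainCode_sub_le hv hp.1 hq.1 ?_)
    rw [letter_eq hv.1 hp.2, letter_eq hv.1 hq.2]
  have h1 : dimH (Icc (0 : ℝ) 1) = 1 := by
    rw [Real.dimH_of_nonempty_interior (by simp), Module.finrank_self, Nat.cast_one]
  have h2 := (dimH_mono (Icc_subset_image_chainCode hv)).trans (hH.dimH_image_le hr0)
  rw [h1, ENNReal.le_div_iff_mul_le (Or.inl (by simpa using hr0.ne')) (Or.inl ENNReal.coe_ne_top),
    one_mul] at h2
  rw [← hr, ENNReal.ofReal_coe_nnreal]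
  exact h2.trans (dimH_mono inter_subset_left)

end Kasner

open Kasner in
theorem mainTheorem1 (v : ℝ) (hv : v ∈ Set.Ioo (1 / 2 : ℝ) 1) :
    IsCantorSet (infiniteChainSet v) ∧
    kasnerLength (infiniteChainSet v) = 0 ∧
    dimH (infiniteChainSet v) ∈ Set.Icc
      (ENNReal.ofReal (Real.log 2 / Real.log ((2 + v ^ 2) / (1 - v ^ 2))))
      (ENNReal.ofReal (min 1 (Real.log 2 /
        Real.log (2 * (1 - v ^ 2) / (1 + 2 * v ^ 2 - √(12 * v ^ 2 - 3)))))) := by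
  refine ⟨isCantorSet_infiniteChainSet hv, kasnerLength_infiniteChainSet hv,
    le_dimH_infiniteChainSet hv, ?_⟩
  rw [ENNReal.ofReal_min, ENNReal.ofReal_one]
  exact le_min (dimH_le_one _) (dimH_infiniteChainSet_le hv)
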